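/- Let $G=(V,E)$ be a finite simple graph, $\Omega=\{+,-\}^V$ (ordered pointwise, $-<+$), $\beta>0$, and let $\mu=\mu_{G,\beta}$ be the Ising Gibbs distribution, $\mu(\sigma)\propto\exp\big(\beta\sum_{\{u,v\}\in E}\sigma(u)\sigma(v)\big)$. For $A\subseteq V$ let $\mathcal{MSW}_A$ be the transition matrix of the following Markov chain on $\Omega$. From $\sigma$: let $E(\sigma)=\{\{u,v\}\in E:\sigma(u)=\sigma(v)\}$; independently delete each edge of $E(\sigma)$ with probability $e^{-2\beta}$ and keep it with probability $1-e^{-2\beta}$, obtaining $F\subseteq E(\sigma)$; then, independently for each connected component $C\subseteq A$ of $(V,F)$, with probability $2^{-(|C|-1)}$ choose a spin uniformly at random from $\{+,-\}$ and assign it to all vertices of $C$, and otherwise leave $C$ unchanged; all vertices in components that are not contained in $A$ keep their spins. The Monotone SW dynamics is the chain with transition matrix $\mathcal{MSW}=\mathcal{MSW}_V$. **(1)** For every finite graph $G$ and every $\beta>0$, the Monotone SW dynamics is ergodic (irreducible and aperiodic), reversible with respect to $\mu$, and monotone, i.e. it has a grand coupling $(X_t^\sigma)_{\sigma\in\Omega}$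 with $X_{t+1}^\sigma\ge X_{t+1}^\tau$ whenever $X_t^\sigma\ge X_t^\tau$. Moreover $\{\mathcal{MSW}_A\}_{A\subseteq V}$ is a censoring for it: every $\mathcal{MSW}_A$ is a monotone stochastic matrix, reversible with respect to $\mu$, which acts on $A$ (i.e. $\mathcal{MSW}_A(\sigma,\sigma')\ne0$ if and only if $\sigma=\sigma'$ on $V\setminus A$), and $\langle \mathcal{MSW} f,g\rangle_\mu\le\langle\mathcal{MSW}_A f,g\rangle_\mu$ for all increasing positive $f,g:\Omega\to\mathbb R$, where $\langle f,g\rangle_\mu=\sum_\sigma\mu(\sigma)f(\sigma)g(\sigma)$. **(2)** Let $\beta_c(d)$ be given by $(d-1)\tanh\beta_c(d)=1$ for $d\ge3$, and $\beta_c(d)=\infty$ for $d\le2$. For every $d$ and every $0<\beta<\beta_c(d)$ there are constants $C,c_1,c_2>0$, depending only on $d$ and $\beta$, such that for every graph $G$ on $n\ge1$ vertices of maximum degree at most $d$, the Monotone SW dynamics on $G$ has mixing time $T_{\mathrm{mix}}\le C\log n$ if $n\ge2$, and relaxation time $c_1\le T_{\mathrm{rel}}\le c_2$. Here $T_{\mathrm{mix}}=\max_{\sigma\in\Omega}\min\{t\ge0:\|\mathcal{MSW}^t(\sigma,\cdot)-\mu\|_{\mathrm{TV}}\le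 1/4\}$, and $T_{\mathrm{rel}}=1/(1-\lambda^*)$, where $\lambda^*$ is the largest absolute value of an eigenvalue of $\mathcal{MSW}$ other than $1$. -/

import Mathlib

open scoped BigOperators

universe u

noncomputable section

namespace MonotoneSW

/-! ### Finite Markov chains, given by a transition matrix -/

section Chains

variable {S : Type*} [Fintype S] [DecidableEq S]

/-- A Markov chain with transition matrix `P` is ergodic: `P` is a stochastic matrix, it is
irreducible, and the period of every state (the gcd of the possible return times) is one. -/
structure IsErgodic (P : Matrix S S ℝ) : Prop where
  stochastic : P ∈ Matrix.rowStochastic ℝ S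
  irreducible : P.IsIrreducible
  aperiodic : ∀ x : S, ∀ k : ℕ, (∀ t : ℕ, 1 ≤ t → 0 < (P ^ t) x x → k ∣ t) → k = 1

/-- Reversibility with respect to `μ` (detailed balance). -/
def IsReversible (μ : S → ℝ) (P : Matrix S S ℝ) : Prop :=
  ∀ x y : S, μ x * P x y = μ y * P y x

/-- The chain has a monotone grand coupling: a probability distribution `κ` on maps
`Φ : S → S` (the simultaneous one-step moves from all the states) such that `Φ x` has law
`P x ·` for every `x`, and such that almost surely `Φ x ≤ Φ y` whenever `x ≤ y`. -/
def IsMonotone [PartialOrder S] (P : Matrix S S ℝ) : Prop :=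
  ∃ κ : (S → S) → ℝ,
    (∀ Φ, 0 ≤ κ Φ) ∧ ∑ Φ, κ Φ = 1 ∧
    (∀ x y : S, ∑ Φ : S → S, (if Φ x = y then κ Φ else 0) = P x y) ∧
    ∀ Φ, κ Φ ≠ 0 → Monotone Φ

/-- Total variation distance of two distributions on a finite set. -/
def tvDist (ν μ : S → ℝ) : ℝ := (1 / 2) * ∑ x, |ν x - μ x|

/-- `T_mix(P, ε)`: the maximum over the initial states `x` of the least `t` such that `P^t(x, ·)`
is within total variation distance `ε` of `μ` (and `⊤` if for some `x` there is no such `t`). -/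
def mixingTime (P : Matrix S S ℝ) (μ : S → ℝ) (ε : ℝ) : ℕ∞ :=
  ⨆ x : S, ⨅ t : ℕ, ⨅ _ : tvDist (fun y => (P ^ t) x y) μ ≤ ε, (t : ℕ∞)

/-- The largest absolute value of an eigenvalue of `P` other than `1`; for an ergodic reversible
chain, whose eigenvalues are `1 = λ₁ > λ₂ ≥ ⋯ ≥ λ_N`, this is `max {|λ₂|, |λ_N|}`. -/
def lambdaStar (P : Matrix S S ℝ) : ℝ :=
  sSup {r : ℝ | ∃ l : ℝ, Module.End.HasEigenvalue (Matrix.toLin' P) l ∧ l ≠ 1 ∧ r = |l|}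

/-- The relaxation time, the inverse of the absolute spectral gap. -/
def relaxationTime (P : Matrix S S ℝ) : ℝ := (1 - lambdaStar P)⁻¹

/-- The inner product of `L²(μ)`. -/
def innerMu (μ f g : S → ℝ) : ℝ := ∑ x, μ x * f x * g x

end Chains

/-! ### The ferromagnetic Ising model -/

/-- Spin configurations; `true` is the spin `+`, `false` is the spin `-`. The order is the
pointwise one, with `- < +`. -/
abbrev Config (V : Type*) := V → Bool

/-- The numerical value of a spin. -/
def spin (b : Bool) : ℝ := if b then 1 else -1

/-- The product of the spins at the two ends of an edge. -/
def edgeSpin {V : Type*} (σ : Config V) : Sym2 V → ℝ :=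
  Sym2.lift ⟨fun u v => spin (σ u) * spin (σ v), fun _ _ => mul_comm _ _⟩

section Ising

variable {V : Type*} [Fintype V] [DecidableEq V] (G : SimpleGraph V) [DecidableRel G.Adj]

/-- The weight `exp (β ∑_{{u,v} ∈ E} σ(u) σ(v))`. -/
def isingWeight (β : ℝ) (σ : Config V) : ℝ :=
  Real.exp (β * ∑ e ∈ G.edgeFinset, edgeSpin σ e)

/-- The Gibbs distribution. -/
def gibbs (β : ℝ) (σ : Config V) : ℝ :=
  isingWeight G β σ / ∑ τ : Config V, isingWeight G β τ

/-- `β_c` is the critical inverse temperature of the infinite `d`-regular tree: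
`(d - 1) tanh β_c = 1`. There is exactly one such `β_c` if `3 ≤ d`, and none if `d ≤ 2`. -/
def IsCriticalBeta (d : ℕ) (βc : ℝ) : Prop :=
  ((d : ℝ) - 1) * Real.tanh βc = 1

/-! ### The Monotone Swendsen-Wang dynamics -/

/-- The set `E(σ)` of agreeing edges. -/
def agreeEdges (σ : Config V) : Finset (Sym2 V) :=
  G.edgeFinset.filter fun e => ∀ u ∈ e, ∀ v ∈ e, σ u = σ v

/-- The probability that the percolation step from `σ` yields `F ⊆ E(σ)`: each edge of `E(σ)` is
kept with probability `1 - exp (-2β)` and deleted with probability `exp (-2β)`. -/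
def percProb (β : ℝ) (σ : Config V) (F : Finset (Sym2 V)) : ℝ :=
  (1 - Real.exp (-2 * β)) ^ F.card * Real.exp (-2 * β) ^ (agreeEdges G σ \ F).card

/-- The subgraph `(V, F)`. -/
abbrev percGraph (F : Finset (Sym2 V)) : SimpleGraph V :=
  SimpleGraph.fromEdgeSet (F : Set (Sym2 V))

open Classical in
/-- The probability that the update of the component with vertex set `C` leads from `σ` to `τ` on
`C`, if components not contained in `A` are frozen: if `C ⊆ A`, then with probability
`1 / 2^(|C| - 1)` all of `C` receives one uniformly random spin `s`, and otherwise `C` keeps its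
spins; if `C ⊄ A`, then `C` keeps its spins. -/
def componentProb (A C : Set V) (σ τ : Config V) : ℝ :=
  if C ⊆ A then
    (1 / 2 ^ (C.ncard - 1)) * ∑ s : Bool, (1 / 2) * (if ∀ v ∈ C, τ v = s then 1 else 0)
      + (1 - 1 / 2 ^ (C.ncard - 1)) * (if ∀ v ∈ C, τ v = σ v then 1 else 0)
  else if ∀ v ∈ C, τ v = σ v then 1 else 0

open Classical in
/-- The transition matrix of the censored Monotone SW dynamics: percolate the agreeing edges, then
update all the components of `(V, F)` independently, those contained in `A` as in the Monotone SW
dynamics, whereas the others keep their spins. -/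
def mswCensored (β : ℝ) (A : Set V) : Matrix (Config V) (Config V) ℝ :=
  fun σ τ => ∑ F ∈ (agreeEdges G σ).powerset,
    percProb G β σ F * ∏ C : (percGraph F).ConnectedComponent, componentProb A C.supp σ τ

/-- The transition matrix of the Monotone SW dynamics (no component is frozen). -/
def msw (β : ℝ) : Matrix (Config V) (Config V) ℝ := mswCensored G β Set.univ

/-! ### Censorings -/

/-- A matrix `Q` acts on `A`: its nonzero entries are exactly those between configurations that
agree off `A`. -/
def ActsOn (A : Set V) (Q : Matrix (Config V) (Config V) ℝ) : Prop :=
  ∀ σ τ : Config V, Q σ τ ≠ 0 ↔ ∀ v, v ∉ A → σ v = τ v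

/-- The comparison `P ≤ Q`: `⟨P f, g⟩_μ ≤ ⟨Q f, g⟩_μ` for all increasing positive `f`, `g`. -/
def CompLE (μ : Config V → ℝ) (P Q : Matrix (Config V) (Config V) ℝ) : Prop :=
  ∀ f g : Config V → ℝ, Monotone f → Monotone g → (∀ σ, 0 < f σ) → (∀ σ, 0 < g σ) →
    innerMu μ (P.mulVec f) g ≤ innerMu μ (Q.mulVec f) g

/-- `(P_A)_{A ⊆ V}` is a censoring for the (ergodic, monotone and `μ`-reversible) chain `P`. -/
structure IsCensoring (μ : Config V → ℝ) (P : Matrix (Config V) (Config V) ℝ)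
    (PA : Set V → Matrix (Config V) (Config V) ℝ) : Prop where
  stochastic : ∀ A, PA A ∈ Matrix.rowStochastic ℝ (Config V)
  monotone : ∀ A, IsMonotone (PA A)
  reversible : ∀ A, IsReversible μ (PA A)
  actsOn : ∀ A, ActsOn A (PA A)
  comparison : ∀ A, CompLE μ P (PA A)

end Ising

end MonotoneSW

end

noncomputable section

namespace MonotoneSW

/-! ### Random mapping representation of the censored dynamics -/

/-- Functions on `V` are families of functions on the fibres of `π : V → ι`, so sums of products
over the fibres factorise. -/
lemma sum_prod_fiber {V ι κ : Type*} [Fintype V] [DecidableEq V] [Fintype ι] [DecidableEq ι]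
    [Fintype κ] (π : V → ι) (φ : ∀ i, ({v // π v = i} → κ) → ℝ) :
    ∑ s : V → κ, ∏ i, φ i (fun v => s v) = ∏ i, ∑ r, φ i r := by
  rw [Fintype.prod_sum]
  refine Fintype.sum_equiv
    (((Equiv.sigmaFiberEquiv π).symm.arrowCongr (Equiv.refl κ)).trans
      (Equiv.piCurry fun _ _ => κ)) _ _ fun s => ?_
  rfl

section Step

variable {V : Type*}

open Classical in
/-- The update of the components of `(V, F)` with independent uniform spins `s`, one for each
vertex: a component contained in `A` on which `s` is constant receives that spin, and all the
others keep their spins. -/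
def step (A : Set V) (F : Finset (Sym2 V)) (s σ : Config V) : Config V := fun v =>
  if ∀ w, (percGraph F).Reachable v w → w ∈ A ∧ s w = true then true
  else if ∀ w, (percGraph F).Reachable v w → w ∈ A ∧ s w = false then false
  else σ v

variable [Fintype V] [DecidableEq V]

lemma sum_update_fiber {X : Type*} [Fintype X] [DecidableEq X] [Nonempty X] (p : Prop)
    [Decidable p] (t c : X → Bool) :
    ∑ r : X → Bool, (if ∀ v, t v = (if p ∧ ∀ w, r w = true then true
        else if p ∧ ∀ w, r w = false then false else c v) then (1 : ℝ) else 0) =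
      2 ^ Fintype.card X * (if p then
        (1 / 2 ^ (Fintype.card X - 1)) * ∑ s : Bool, (1 / 2) * (if ∀ v, t v = s then 1 else 0)
          + (1 - 1 / 2 ^ (Fintype.card X - 1)) * (if ∀ v, t v = c v then 1 else 0)
        else if ∀ v, t v = c v then 1 else 0) := by
  by_cases hp : p
  · simp only [hp, true_and, if_true]
    obtain ⟨m, hm⟩ : ∃ m, Fintype.card X = m + 1 :=
      ⟨_, (Nat.succ_pred_eq_of_pos Fintype.card_pos).symm⟩
    obtain ⟨x₀⟩ := ‹Nonempty X›
    have key : ∀ r : X → Bool, (if ∀ v, t v = (if ∀ w, r w = true then true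
        else if ∀ w, r w = false then false else c v) then (1 : ℝ) else 0) =
        (if ∀ v, t v = c v then 1 else 0)
        + (if r = fun _ => true then
            (if ∀ v, t v = true then 1 else 0) - (if ∀ v, t v = c v then 1 else 0) else 0)
        + (if r = fun _ => false then
            (if ∀ v, t v = false then 1 else 0) - (if ∀ v, t v = c v then 1 else 0) else 0) := by
      intro r
      by_cases h1 : r = fun _ => true
      · have h2 : (fun _ => true : X → Bool) ≠ fun _ => false := fun h => by
          simpa using congrFun h x₀
        subst h1
        simp [h2]
      · have h1' : ¬ ∀ w, r w = true := fun h => h1 (funext h)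
        by_cases h2 : r = fun _ => false
        · subst h2
          have : ¬ ∀ w : X, (fun _ => false : X → Bool) w = true := h1'
          rw [if_neg h1]
          simp only [if_neg this]
          simp
        · have h2' : ¬ ∀ w, r w = false := fun h => h2 (funext h)
          simp only [if_neg h1, if_neg h2, if_neg h1', if_neg h2', add_zero]
    rw [Finset.sum_congr rfl fun r _ => key r, Finset.sum_add_distrib, Finset.sum_add_distrib]
    simp only [Finset.sum_ite_eq', Finset.mem_univ, if_true, Finset.sum_const, Finset.card_univ,
      Fintype.card_fun, Fintype.card_bool, hm, Fintype.sum_bool, nsmul_eq_mul, Nat.cast_pow,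
      Nat.cast_ofNat, Nat.add_sub_cancel]
    have : (2 : ℝ) ^ m ≠ 0 := by positivity
    field_simp
    ring
  · simp [hp]

open Classical in
lemma sum_step_eq (A : Set V) (F : Finset (Sym2 V)) (σ τ : Config V) :
    ∑ s : Config V, (if step A F s σ = τ then (1 : ℝ) else 0) =
      2 ^ Fintype.card V *
        ∏ C : (percGraph F).ConnectedComponent, componentProb A C.supp σ τ := by
  set π : V → (percGraph F).ConnectedComponent := (percGraph F).connectedComponentMk with hπ
  have hcond : ∀ (C : (percGraph F).ConnectedComponent) (s : Config V) (b : Bool) (v : V),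
      π v = C → ((∀ w, (percGraph F).Reachable v w → w ∈ A ∧ s w = b) ↔
        (C.supp ⊆ A ∧ ∀ w : {w // π w = C}, s w = b)) := by
    rintro C s b v rfl
    constructor
    · intro h
      refine ⟨fun w hw => (h w ?_).1, fun w => (h w ?_).2⟩
      · exact (SimpleGraph.ConnectedComponent.exact hw).symm
      · exact (SimpleGraph.ConnectedComponent.exact w.2).symm
    · rintro ⟨h1, h2⟩ w hw
      have hw' : π w = π v := SimpleGraph.ConnectedComponent.sound hw.symm
      exact ⟨h1 hw', h2 ⟨w, hw'⟩⟩
  let φ : ∀ C : (percGraph F).ConnectedComponent, ({v // π v = C} → Bool) → ℝ := fun C r =>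
    if ∀ v : {v // π v = C}, τ v = (if C.supp ⊆ A ∧ ∀ w, r w = true then true
      else if C.supp ⊆ A ∧ ∀ w, r w = false then false else σ v) then (1 : ℝ) else 0
  have h1 : ∀ s : Config V, (if step A F s σ = τ then (1 : ℝ) else 0) =
      ∏ C, φ C (fun v => s v) := by
    intro s
    have hiff : step A F s σ = τ ↔ ∀ (C : (percGraph F).ConnectedComponent)
        (v : {v // π v = C}), τ v = (if C.supp ⊆ A ∧ ∀ w : {v // π v = C}, s w = true then true
          else if C.supp ⊆ A ∧ ∀ w : {v // π v = C}, s w = false then false else σ v) := by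
      constructor
      · rintro rfl C v
        simp only [step, hcond C s _ v v.2]
      · intro h
        funext v
        rw [h (π v) ⟨v, rfl⟩]
        simp only [step, hcond (π v) s _ v rfl]
    by_cases hs : step A F s σ = τ
    · rw [if_pos hs]
      exact (Finset.prod_eq_one fun C _ => if_pos (hiff.1 hs C)).symm
    · rw [if_neg hs]
      rw [hiff, not_forall] at hs
      obtain ⟨C, hC⟩ := hs
      exact (Finset.prod_eq_zero (Finset.mem_univ C) (if_neg hC)).symm
  rw [Finset.sum_congr rfl fun s _ => h1 s, sum_prod_fiber π φ]
  have hne : ∀ C : (percGraph F).ConnectedComponent, Nonempty {v // π v = C} := by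
    intro C
    induction C using SimpleGraph.ConnectedComponent.ind with
    | h v => exact ⟨⟨v, rfl⟩⟩
  have h2 : ∀ C : (percGraph F).ConnectedComponent, ∑ r, φ C r =
      2 ^ Fintype.card {v // π v = C} * componentProb A C.supp σ τ := by
    intro C
    have hcard : C.supp.ncard = Fintype.card {v // π v = C} := by
      rw [← Nat.card_eq_fintype_card]
      rfl
    refine Eq.trans (Finset.sum_congr rfl fun r _ => ?_)
      ((sum_update_fiber (C.supp ⊆ A) (fun v : {v // π v = C} => τ v) (fun v => σ v)).trans ?_)
    · simp only [φ]
    · rw [componentProb, hcard]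
      simp only [Subtype.forall]
      rfl
  rw [Finset.prod_congr rfl fun C _ => h2 C, Finset.prod_mul_distrib, Finset.prod_pow_eq_pow_sum,
    ← Fintype.card_sigma, Fintype.card_congr (Equiv.sigmaFiberEquiv π)]

end Step

/-- Percolation on a subset of the edges is the restriction of percolation on all of them. -/
lemma sum_powerset_inter {α : Type*} [DecidableEq α] {S E : Finset α} (h : S ⊆ E) (p q : ℝ)
    (hpq : p + q = 1) (H : Finset α → ℝ) :
    ∑ ω ∈ E.powerset, p ^ ω.card * q ^ (E \ ω).card * H (ω ∩ S) =
      ∑ F ∈ S.powerset, p ^ F.card * q ^ (S \ F).card * H F := by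
  have key : ∀ T : Finset α, Disjoint S T →
      ∑ ω ∈ (S ∪ T).powerset, p ^ ω.card * q ^ ((S ∪ T) \ ω).card * H (ω ∩ S) =
      ∑ F ∈ S.powerset, p ^ F.card * q ^ (S \ F).card * H F := by
    intro T
    induction T using Finset.induction_on with
    | empty =>
      intro _
      rw [Finset.union_empty]
      refine Finset.sum_congr rfl fun F hF => ?_
      rw [Finset.inter_eq_left.2 (Finset.mem_powerset.1 hF)]
    | insert e T he ih =>
      intro hd
      rw [Finset.disjoint_insert_right] at hd
      have heS : e ∉ S ∪ T := by simp [hd.1, he]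
      rw [Finset.union_insert, Finset.sum_powerset_insert heS, ← Finset.sum_add_distrib, ← ih hd.2]
      refine Finset.sum_congr rfl fun ω hω => ?_
      have hω' := Finset.mem_powerset.1 hω
      have heω : e ∉ ω := fun h => heS (hω' h)
      have h1 : insert e (S ∪ T) \ ω = insert e ((S ∪ T) \ ω) := Finset.insert_sdiff_of_notMem _ heω
      have h2 : insert e (S ∪ T) \ insert e ω = (S ∪ T) \ ω := by
        ext x
        simp only [Finset.mem_sdiff, Finset.mem_insert]
        constructor
        · tauto
        · rintro ⟨hx, hxω⟩
          refine ⟨Or.inr hx, ?_⟩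
          rintro (rfl | h)
          exacts [heS hx, hxω h]
      rw [h1, h2, Finset.card_insert_of_notMem heω,
        Finset.card_insert_of_notMem (by simp [heS]), Finset.insert_inter_of_notMem hd.1,
        pow_succ, pow_succ]
      linear_combination (p ^ ω.card * q ^ ((S ∪ T) \ ω).card * H (ω ∩ S)) * hpq
  have := key (E \ S) Finset.disjoint_sdiff
  rwa [Finset.union_sdiff_of_subset h] at this

section Rep

variable {V : Type*} [Fintype V] [DecidableEq V] (G : SimpleGraph V) [DecidableRel G.Adj]

/-- The probability that percolation on all the edges, with retention probability
`1 - exp (-2β)`, yields `ω`. -/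
def coinWeight (β : ℝ) (ω : Finset (Sym2 V)) : ℝ :=
  (1 - Real.exp (-2 * β)) ^ ω.card * Real.exp (-2 * β) ^ (G.edgeFinset \ ω).card

lemma exp_neg_two_mul_lt_one {β : ℝ} (hβ : 0 < β) : Real.exp (-2 * β) < 1 :=
  by
  rw [Real.exp_lt_one_iff]
  linarith

lemma coinWeight_nonneg {β : ℝ} (hβ : 0 < β) (ω : Finset (Sym2 V)) : 0 ≤ coinWeight G β ω := by
  have := exp_neg_two_mul_lt_one hβ
  unfold coinWeight
  have : 0 ≤ 1 - Real.exp (-2 * β) := by linarith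
  positivity

lemma agreeEdges_subset (σ : Config V) : agreeEdges G σ ⊆ G.edgeFinset := Finset.filter_subset _ _

lemma sum_coinWeight_inter (β : ℝ) (σ : Config V) (H : Finset (Sym2 V) → ℝ) :
    ∑ ω ∈ G.edgeFinset.powerset, coinWeight G β ω * H (ω ∩ agreeEdges G σ) =
      ∑ F ∈ (agreeEdges G σ).powerset, percProb G β σ F * H F :=
  sum_powerset_inter (agreeEdges_subset G σ) _ _ (by ring) H

lemma sum_coinWeight (β : ℝ) : ∑ ω ∈ G.edgeFinset.powerset, coinWeight G β ω = 1 := by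
  have h := Finset.sum_pow_mul_eq_add_pow (1 - Real.exp (-2 * β)) (Real.exp (-2 * β)) G.edgeFinset
  rw [sub_add_cancel, one_pow] at h
  rw [← h]
  refine Finset.sum_congr rfl fun ω hω => ?_
  rw [coinWeight, Finset.card_sdiff_of_subset (Finset.mem_powerset.1 hω)]

/-- One step of the censored dynamics from `σ`, as a function of the set `ω` of open edges and of
the proposed spins `s`. -/
def stepMap (A : Set V) (ω : Finset (Sym2 V)) (s σ : Config V) : Config V :=
  step A (ω ∩ agreeEdges G σ) s σ

/-- The random mapping representation of the censored dynamics. -/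
lemma mswCensored_eq (β : ℝ) (A : Set V) (σ τ : Config V) :
    mswCensored G β A σ τ = ∑ ω ∈ G.edgeFinset.powerset, ∑ s : Config V,
      coinWeight G β ω * (1 / 2) ^ Fintype.card V *
        (if stepMap G A ω s σ = τ then 1 else 0) := by
  classical
  have h := sum_coinWeight_inter G β σ fun F =>
    (1 / 2) ^ Fintype.card V * ∑ s : Config V, (if step A F s σ = τ then (1 : ℝ) else 0)
  rw [mswCensored]
  trans
  swap
  · refine (h.symm.trans ?_)
    refine Finset.sum_congr rfl fun ω _ => ?_
    rw [Finset.mul_sum, Finset.mul_sum]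
    refine Finset.sum_congr rfl fun s _ => ?_
    rw [mul_assoc]
    rfl
  · refine Finset.sum_congr rfl fun F _ => ?_
    congr 1
    rw [sum_step_eq, ← mul_assoc, ← mul_pow]
    norm_num

lemma mswCensored_mulVec (β : ℝ) (A : Set V) (f : Config V → ℝ) (σ : Config V) :
    (mswCensored G β A).mulVec f σ = ∑ ω ∈ G.edgeFinset.powerset, ∑ s : Config V,
      coinWeight G β ω * (1 / 2) ^ Fintype.card V * f (stepMap G A ω s σ) := by
  simp only [Matrix.mulVec, dotProduct, mswCensored_eq, Finset.sum_mul]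
  rw [Finset.sum_comm]
  refine Finset.sum_congr rfl fun ω _ => ?_
  rw [Finset.sum_comm]
  refine Finset.sum_congr rfl fun s _ => ?_
  simp [mul_assoc]

lemma sum_stepWeight (β : ℝ) : ∑ ω ∈ G.edgeFinset.powerset, ∑ _s : Config V,
    coinWeight G β ω * (1 / 2) ^ Fintype.card V = 1 := by
  refine (Finset.sum_congr rfl fun ω _ => ?_).trans (sum_coinWeight G β)
  rw [Finset.sum_const, Finset.card_univ, Fintype.card_fun, Fintype.card_bool, nsmul_eq_mul,
    mul_left_comm, Nat.cast_pow, Nat.cast_ofNat, ← mul_pow]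
  norm_num

variable {G}

lemma mem_agreeEdges {σ : Config V} {u v : V} :
    s(u, v) ∈ agreeEdges G σ ↔ G.Adj u v ∧ σ u = σ v := by
  simp only [agreeEdges, Finset.mem_filter, SimpleGraph.mem_edgeFinset, SimpleGraph.mem_edgeSet,
    Sym2.mem_iff]
  constructor
  · rintro ⟨h, h'⟩
    exact ⟨h, h' u (.inl rfl) v (.inr rfl)⟩
  · rintro ⟨h, h'⟩
    refine ⟨h, ?_⟩
    rintro a (rfl | rfl) b (rfl | rfl) <;> simp [h']

lemma percGraph_adj_iff {ω : Finset (Sym2 V)} {σ : Config V} {u v : V} :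
    (percGraph (ω ∩ agreeEdges G σ)).Adj u v ↔ s(u, v) ∈ ω ∧ G.Adj u v ∧ σ u = σ v := by
  simp only [SimpleGraph.fromEdgeSet_adj, Finset.coe_inter, Set.mem_inter_iff, Finset.mem_coe,
    mem_agreeEdges]
  constructor
  · rintro ⟨⟨h, h'⟩, -⟩
    exact ⟨h, h'⟩
  · rintro ⟨h, h'⟩
    exact ⟨⟨h, h'⟩, h'.1.ne⟩

/-- If `τ` has the spin `b` wherever `σ` has it, then the component in `σ` of a vertex with spin
`b` is contained in its component in `τ`. -/
lemma Reachable.of_spin_imp {ω : Finset (Sym2 V)} {σ τ : Config V} {b : Bool}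
    (h : ∀ x, σ x = b → τ x = b) {v w : V} (hv : σ v = b)
    (hw : (percGraph (ω ∩ agreeEdges G σ)).Reachable v w) :
    (percGraph (ω ∩ agreeEdges G τ)).Reachable v w := by
  rw [SimpleGraph.reachable_iff_reflTransGen] at hw
  have : (percGraph (ω ∩ agreeEdges G τ)).Reachable v w ∧ σ w = b := by
    induction hw with
    | refl => exact ⟨.refl _, hv⟩
    | tail _ hadj ih =>
      rw [percGraph_adj_iff] at hadj
      have hc := hadj.2.2.symm.trans ih.2
      refine ⟨ih.1.trans (SimpleGraph.Adj.reachable ?_), hc⟩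
      rw [percGraph_adj_iff]
      exact ⟨hadj.1, hadj.2.1, (h _ ih.2).trans (h _ hc).symm⟩
  exact this.1

lemma stepMap_monotone (A : Set V) (ω : Finset (Sym2 V)) (s : Config V) :
    Monotone (stepMap G A ω s) := by
  intro τ σ hle v
  have hT : ∀ x, τ x = true → σ x = true := fun x hx => by
    have := Bool.le_iff_imp.1 (hle x)
    exact this hx
  have hF : ∀ x, σ x = false → τ x = false := fun x hx => by
    have := Bool.le_iff_imp.1 (hle x)
    simpa [hx] using this
  rw [Bool.le_iff_imp]
  simp only [stepMap, step]
  intro h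
  by_cases hv : σ v = true
  · split_ifs with h1 h2
    · rfl
    · exfalso
      have hsv : s v = false := (h2 v (.refl _)).2
      split_ifs at h with h3 h4
      · have := (h3 v (.refl _)).2
        simp [hsv] at this
      · exact h4 fun w hw => h2 w (Reachable.of_spin_imp hT h hw)
    · exact hv
  · have hv : σ v = false := by simpa using hv
    have hτ := hF v hv
    split_ifs at h with h3 h4
    · rw [if_pos]
      exact fun w hw => h3 w (Reachable.of_spin_imp hF hv hw)
    · simp [hτ] at h

variable (G)

theorem mswCensored_isMonotone {β : ℝ} (hβ : 0 < β) (A : Set V) :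
    IsMonotone (mswCensored G β A) := by
  refine ⟨fun Φ => ∑ ω ∈ G.edgeFinset.powerset, ∑ s : Config V,
    coinWeight G β ω * (1 / 2) ^ Fintype.card V * (if stepMap G A ω s = Φ then 1 else 0),
    fun Φ => ?_, ?_, fun σ τ => ?_, fun Φ hΦ => ?_⟩
  · refine Finset.sum_nonneg fun ω _ => Finset.sum_nonneg fun s _ => ?_
    have := coinWeight_nonneg G hβ ω
    split_ifs <;> positivity
  · rw [Finset.sum_comm]
    refine (Finset.sum_congr rfl fun ω _ => ?_).trans (sum_stepWeight G β)
    rw [Finset.sum_comm]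
    refine Finset.sum_congr rfl fun s _ => ?_
    simp
  · rw [mswCensored_eq]
    simp only [← Finset.sum_filter]
    rw [Finset.sum_comm]
    refine Finset.sum_congr rfl fun ω _ => ?_
    rw [Finset.sum_comm]
    refine Finset.sum_congr rfl fun s _ => ?_
    rw [← Finset.mul_sum]
    simp [Finset.sum_ite_eq]
  · obtain ⟨ω, _, h⟩ := Finset.exists_ne_zero_of_sum_ne_zero hΦ
    obtain ⟨s, _, h⟩ := Finset.exists_ne_zero_of_sum_ne_zero h
    by_cases hs : stepMap G A ω s = Φ
    · exact hs ▸ stepMap_monotone A ω s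
    · simp [hs] at h

theorem mswCensored_mem_rowStochastic {β : ℝ} (hβ : 0 < β) (A : Set V) :
    mswCensored G β A ∈ Matrix.rowStochastic ℝ (Config V) := by
  rw [Matrix.mem_rowStochastic_iff_sum]
  constructor
  · intro σ τ
    rw [mswCensored_eq]
    refine Finset.sum_nonneg fun ω _ => Finset.sum_nonneg fun s _ => ?_
    have := coinWeight_nonneg G hβ ω
    split_ifs <;> positivity
  · intro σ
    have := mswCensored_mulVec G β A (fun _ => 1) σ
    simp only [mul_one, sum_stepWeight] at this
    simpa [Matrix.mulVec, dotProduct] using this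

end Rep

/-! ### Correlations on the cube -/

section Cube

variable {ι : Type*} [Fintype ι] [DecidableEq ι]

lemma sum_update_true_add_false (i : ι) (H : (ι → Bool) → ℝ) :
    ∑ ξ, (H (Function.update ξ i true) + H (Function.update ξ i false)) = 2 * ∑ ξ, H ξ := by
  have hinv : Function.Involutive fun ξ : ι → Bool => Function.update ξ i (!ξ i) := by
    intro ξ
    simp
  have h : ∀ ξ : ι → Bool, H (Function.update ξ i true) + H (Function.update ξ i false) =
      H ξ + H (hinv.toPerm _ ξ) := by
    intro ξ
    have h1 : hinv.toPerm _ ξ = Function.update ξ i (!ξ i) := rfl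
    rw [h1]
    cases hξ : ξ i
    · have : Function.update ξ i false = ξ := by rw [← hξ, Function.update_eq_self]
      rw [this, Bool.not_false, add_comm]
    · have : Function.update ξ i true = ξ := by rw [← hξ, Function.update_eq_self]
      rw [this, Bool.not_true]
  rw [Finset.sum_congr rfl fun ξ _ => h ξ, Finset.sum_add_distrib, Equiv.sum_comp, two_mul]

/-- The single-spin kernel that refreshes the spin with probability `a`. -/
def refreshKernel (a : ℝ) (x y : Bool) : ℝ := a / 2 + (1 - a) * (if x = y then 1 else 0)

lemma refreshKernel_comm (a : ℝ) (x y : Bool) : refreshKernel a x y = refreshKernel a y x := by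
  simp only [refreshKernel, eq_comm]

lemma refreshKernel_nonneg {a : ℝ} (h0 : 0 ≤ a) (h1 : a ≤ 1) (x y : Bool) :
    0 ≤ refreshKernel a x y := by
  unfold refreshKernel
  split_ifs <;> linarith

lemma refreshKernel_zero_sub (a : ℝ) (x y : Bool) :
    refreshKernel 0 x y - refreshKernel a x y = a / 2 * (spin x * spin y) := by
  cases x <;> cases y <;> simp [refreshKernel, spin] <;> ring

/-- The bilinear form of the product of the kernels `refreshKernel (α i)`. -/
def refreshForm (α : ι → ℝ) (g f : (ι → Bool) → ℝ) : ℝ :=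
  ∑ ξ, ∑ ξ', g ξ * f ξ' * ∏ i, refreshKernel (α i) (ξ i) (ξ' i)

lemma sum_mul_spin_nonneg {g f : (ι → Bool) → ℝ} (hg : Monotone g) (hf : Monotone f) (i : ι)
    (R : (ι → Bool) → (ι → Bool) → ℝ) (hR : ∀ ξ ξ', 0 ≤ R ξ ξ')
    (hR1 : ∀ ξ ξ' b, R (Function.update ξ i b) ξ' = R ξ ξ')
    (hR2 : ∀ ξ ξ' b, R ξ (Function.update ξ' i b) = R ξ ξ') :
    0 ≤ ∑ ξ, ∑ ξ', g ξ * f ξ' * (spin (ξ i) * spin (ξ' i)) * R ξ ξ' := by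
  have hle : ∀ ξ : ι → Bool, Function.update ξ i false ≤ Function.update ξ i true := fun ξ =>
    update_le_update_iff.2 ⟨Bool.false_le _, fun _ _ => le_rfl⟩
  have h4 : 4 * ∑ ξ, ∑ ξ', g ξ * f ξ' * (spin (ξ i) * spin (ξ' i)) * R ξ ξ' =
      ∑ ξ, ∑ ξ', (g (Function.update ξ i true) - g (Function.update ξ i false)) *
        (f (Function.update ξ' i true) - f (Function.update ξ' i false)) * R ξ ξ' := by
    have e1 := sum_update_true_add_false i
      (fun ξ => ∑ ξ', g ξ * f ξ' * (spin (ξ i) * spin (ξ' i)) * R ξ ξ')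
    have e2 : (4 : ℝ) = 2 * 2 := by norm_num
    rw [e2, mul_assoc, ← e1, Finset.mul_sum]
    refine Finset.sum_congr rfl fun ξ _ => ?_
    rw [← Finset.sum_add_distrib, ← sum_update_true_add_false i]
    refine Finset.sum_congr rfl fun ξ' _ => ?_
    simp only [hR1, hR2, Function.update_self, spin, if_true, Bool.false_eq_true, if_false]
    ring
  have : 0 ≤ 4 * ∑ ξ, ∑ ξ', g ξ * f ξ' * (spin (ξ i) * spin (ξ' i)) * R ξ ξ' := by
    rw [h4]
    refine Finset.sum_nonneg fun ξ _ => Finset.sum_nonneg fun ξ' _ =>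
      mul_nonneg (mul_nonneg ?_ ?_) (hR ξ ξ')
    · exact sub_nonneg.2 (hg (hle ξ))
    · exact sub_nonneg.2 (hf (hle ξ'))
  linarith

lemma refreshForm_le_update {α : ι → ℝ} (h0 : ∀ i, 0 ≤ α i) (h1 : ∀ i, α i ≤ 1)
    {g f : (ι → Bool) → ℝ} (hg : Monotone g) (hf : Monotone f) (i : ι) :
    refreshForm α g f ≤ refreshForm (Function.update α i 0) g f := by
  set R : (ι → Bool) → (ι → Bool) → ℝ := fun ξ ξ' =>
    ∏ j ∈ Finset.univ.erase i, refreshKernel (α j) (ξ j) (ξ' j) with hR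
  have key := sum_mul_spin_nonneg hg hf i R
    (fun ξ ξ' => Finset.prod_nonneg fun j _ => refreshKernel_nonneg (h0 j) (h1 j) _ _)
    (fun ξ ξ' b => Finset.prod_congr rfl fun j hj => by
      rw [Function.update_of_ne (Finset.ne_of_mem_erase hj)])
    (fun ξ ξ' b => Finset.prod_congr rfl fun j hj => by
      rw [Function.update_of_ne (Finset.ne_of_mem_erase hj)])
  have hdiff : refreshForm (Function.update α i 0) g f - refreshForm α g f =
      α i / 2 * ∑ ξ, ∑ ξ', g ξ * f ξ' * (spin (ξ i) * spin (ξ' i)) * R ξ ξ' := by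
    rw [refreshForm, refreshForm, ← Finset.sum_sub_distrib, Finset.mul_sum]
    refine Finset.sum_congr rfl fun ξ _ => ?_
    rw [← Finset.sum_sub_distrib, Finset.mul_sum]
    refine Finset.sum_congr rfl fun ξ' _ => ?_
    have e : ∏ j ∈ Finset.univ.erase i, refreshKernel (Function.update α i 0 j) (ξ j) (ξ' j) =
        R ξ ξ' := Finset.prod_congr rfl fun j hj => by
      rw [Function.update_of_ne (Finset.ne_of_mem_erase hj)]
    rw [← Finset.mul_prod_erase _ _ (Finset.mem_univ i),
      ← Finset.mul_prod_erase _ (fun j => refreshKernel (α j) (ξ j) (ξ' j)) (Finset.mem_univ i),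
      e, Function.update_self]
    have := refreshKernel_zero_sub (α i) (ξ i) (ξ' i)
    simp only [hR] at *
    linear_combination (g ξ * f ξ' *
      ∏ j ∈ Finset.univ.erase i, refreshKernel (α j) (ξ j) (ξ' j)) * this
  have := mul_nonneg (div_nonneg (h0 i) zero_le_two) key
  linarith

lemma refreshForm_le_piecewise {α : ι → ℝ} (h0 : ∀ i, 0 ≤ α i) (h1 : ∀ i, α i ≤ 1)
    {g f : (ι → Bool) → ℝ} (hg : Monotone g) (hf : Monotone f) (S : Finset ι) :
    refreshForm α g f ≤ refreshForm (S.piecewise 0 α) g f := by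
  induction S using Finset.induction_on with
  | empty => simp
  | insert i S _ ih =>
    rw [Finset.piecewise_insert]
    refine ih.trans (refreshForm_le_update ?_ ?_ hg hf i)
    · intro j
      by_cases hj : j ∈ S <;> simp [hj, h0 j]
    · intro j
      by_cases hj : j ∈ S <;> simp [hj, h1 j]

end Cube

/-! ### Reversibility and the comparison inequality -/

section Reversible

variable {V : Type*} [Fintype V] [DecidableEq V] (G : SimpleGraph V) [DecidableRel G.Adj]

omit [DecidableEq V] in
lemma isingWeight_pos (β : ℝ) (σ : Config V) : 0 < isingWeight G β σ := Real.exp_pos _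

lemma sum_isingWeight_pos (β : ℝ) : 0 < ∑ τ : Config V, isingWeight G β τ :=
  Finset.sum_pos (fun τ _ => isingWeight_pos G β τ) Finset.univ_nonempty

lemma gibbs_pos (β : ℝ) (σ : Config V) : 0 < gibbs G β σ :=
  div_pos (isingWeight_pos G β σ) (sum_isingWeight_pos G β)

lemma sum_gibbs (β : ℝ) : ∑ σ : Config V, gibbs G β σ = 1 := by
  simp only [gibbs]
  rw [← Finset.sum_div, div_self (sum_isingWeight_pos G β).ne']

lemma sum_edgeSpin (σ : Config V) :
    ∑ e ∈ G.edgeFinset, edgeSpin σ e =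
      2 * ((agreeEdges G σ).card : ℝ) - (G.edgeFinset.card : ℝ) := by
  have h : ∀ e ∈ G.edgeFinset, edgeSpin σ e = 2 * (if e ∈ agreeEdges G σ then 1 else 0) - 1 := by
    intro e he
    induction e using Sym2.ind with
    | h u v =>
      have hadj : G.Adj u v := by simpa using he
      simp only [mem_agreeEdges, hadj, true_and, edgeSpin, Sym2.lift_mk]
      cases σ u <;> cases σ v <;> norm_num [spin]
  rw [Finset.sum_congr rfl h, Finset.sum_sub_distrib, ← Finset.mul_sum, Finset.sum_boole,
    Finset.filter_mem_eq_inter, Finset.inter_eq_right.2 (agreeEdges_subset G σ)]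
  simp

lemma isingWeight_mul_percProb (β : ℝ) {σ : Config V} {F : Finset (Sym2 V)}
    (hF : F ⊆ agreeEdges G σ) :
    isingWeight G β σ * percProb G β σ F =
      Real.exp (-β * G.edgeFinset.card) *
        ((1 - Real.exp (-2 * β)) / Real.exp (-2 * β)) ^ F.card := by
  have hpos := Real.exp_pos (-2 * β)
  have h1 : isingWeight G β σ =
      Real.exp (-β * G.edgeFinset.card) / Real.exp (-2 * β) ^ (agreeEdges G σ).card := by
    rw [isingWeight, sum_edgeSpin, ← Real.exp_nat_mul, ← Real.exp_sub]
    congr 1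
    ring
  rw [h1, percProb, Finset.card_sdiff_of_subset hF, div_pow,
    pow_sub₀ _ hpos.ne' (Finset.card_le_card hF)]
  field_simp

variable {G}

lemma eq_of_reachable {F : Finset (Sym2 V)} {σ : Config V} (hF : F ⊆ agreeEdges G σ) {v w : V}
    (h : (percGraph F).Reachable v w) : σ v = σ w := by
  rw [SimpleGraph.reachable_iff_reflTransGen] at h
  induction h with
  | refl => rfl
  | tail _ hadj ih =>
    rw [SimpleGraph.fromEdgeSet_adj] at hadj
    exact ih.trans (mem_agreeEdges.1 (hF (Finset.mem_coe.1 hadj.1))).2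

variable (G) in
lemma subset_agreeEdges_comp_mk {F : Finset (Sym2 V)} (hF : F ⊆ G.edgeFinset)
    (ξ : (percGraph F).ConnectedComponent → Bool) :
    F ⊆ agreeEdges G (fun v => ξ ((percGraph F).connectedComponentMk v)) := by
  intro e he
  induction e using Sym2.ind with
  | h u v =>
    have hadj : G.Adj u v := by simpa using hF he
    refine mem_agreeEdges.2 ⟨hadj, congrArg ξ (SimpleGraph.ConnectedComponent.sound ?_)⟩
    refine SimpleGraph.Adj.reachable ?_
    rw [SimpleGraph.fromEdgeSet_adj]
    exact ⟨he, hadj.ne⟩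

omit [Fintype V] [DecidableEq V] in
lemma connectedComponentMk_out {H : SimpleGraph V} (C : H.ConnectedComponent) :
    H.connectedComponentMk C.out = C := Quot.out_eq C

open Classical in
/-- The probability that the component `C` is refreshed. -/
def refreshProb (A : Set V) (C : Set V) : ℝ := if C ⊆ A then 1 / 2 ^ (C.ncard - 1) else 0

omit [Fintype V] [DecidableEq V] in
lemma refreshProb_nonneg (A C : Set V) : 0 ≤ refreshProb A C := by
  unfold refreshProb
  split_ifs <;> positivity

omit [Fintype V] [DecidableEq V] in
lemma refreshProb_le_one (A C : Set V) : refreshProb A C ≤ 1 := by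
  unfold refreshProb
  split_ifs
  · rw [div_le_one (by positivity)]
    exact one_le_pow₀ (by norm_num)
  · norm_num

lemma componentProb_eq_refreshKernel (A : Set V) {F : Finset (Sym2 V)} {σ τ : Config V}
    (hσ : F ⊆ agreeEdges G σ) (hτ : F ⊆ agreeEdges G τ) (C : (percGraph F).ConnectedComponent) :
    componentProb A C.supp σ τ =
      refreshKernel (refreshProb A C.supp) (σ C.out) (τ C.out) := by
  classical
  have hout : ∀ v ∈ C.supp, (percGraph F).Reachable v C.out := fun v hv =>
    SimpleGraph.ConnectedComponent.exact (hv.trans (connectedComponentMk_out C).symm)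
  have hmem : C.out ∈ C.supp := connectedComponentMk_out C
  have h1 : ∀ s, (∀ v ∈ C.supp, τ v = s) ↔ τ C.out = s := fun s =>
    ⟨fun h => h _ hmem, fun h v hv => (eq_of_reachable hτ (hout v hv)).trans h⟩
  have h2 : (∀ v ∈ C.supp, τ v = σ v) ↔ σ C.out = τ C.out :=
    ⟨fun h => (h _ hmem).symm, fun h v hv => (eq_of_reachable hτ (hout v hv)).trans
      (h.symm.trans (eq_of_reachable hσ (hout v hv)).symm)⟩
  simp only [componentProb, h1, h2, refreshKernel, refreshProb]
  by_cases hC : C.supp ⊆ A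
  · simp only [if_pos hC, Fintype.sum_bool]
    cases τ C.out <;> simp <;> ring
  · simp [if_neg hC]

lemma prod_componentProb_eq_zero (A : Set V) {F : Finset (Sym2 V)} {σ τ : Config V}
    (hσ : F ⊆ agreeEdges G σ) (hτ : ¬ F ⊆ agreeEdges G τ) :
    ∏ C : (percGraph F).ConnectedComponent, componentProb A C.supp σ τ = 0 := by
  rw [Finset.not_subset] at hτ
  obtain ⟨e, heF, he⟩ := hτ
  induction e using Sym2.ind with
  | h u v =>
    have hσe := mem_agreeEdges.1 (hσ heF)
    have hne : τ u ≠ τ v := fun h => he (mem_agreeEdges.2 ⟨hσe.1, h⟩)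
    have hr : (percGraph F).Reachable v u := by
      refine SimpleGraph.Adj.reachable ?_
      rw [SimpleGraph.fromEdgeSet_adj, Sym2.eq_swap]
      exact ⟨heF, hσe.1.ne.symm⟩
    set C := (percGraph F).connectedComponentMk u with hC
    have hu : u ∈ C.supp := rfl
    have hv : v ∈ C.supp := SimpleGraph.ConnectedComponent.sound hr
    refine Finset.prod_eq_zero (Finset.mem_univ C) ?_
    have h1 : ∀ s, ¬ ∀ w ∈ C.supp, τ w = s := fun s h => hne ((h u hu).trans (h v hv).symm)
    have h2 : ¬ ∀ w ∈ C.supp, τ w = σ w := fun h =>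
      hne ((h u hu).trans (hσe.2.trans (h v hv).symm))
    simp only [componentProb, h1, h2, if_false, mul_zero, Finset.sum_const_zero, add_zero,
      ite_self]

variable (G)

/-- The weight of `F` in the random-cluster expansion, up to the number of components. -/
def clusterWeight (β : ℝ) (F : Finset (Sym2 V)) : ℝ :=
  Real.exp (-β * G.edgeFinset.card) * ((1 - Real.exp (-2 * β)) / Real.exp (-2 * β)) ^ F.card /
    ∑ τ : Config V, isingWeight G β τ

lemma clusterWeight_nonneg {β : ℝ} (hβ : 0 < β) (F : Finset (Sym2 V)) :
    0 ≤ clusterWeight G β F := by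
  have h1 := exp_neg_two_mul_lt_one hβ
  have h2 : 0 ≤ 1 - Real.exp (-2 * β) := by linarith
  have h3 := (sum_isingWeight_pos G β).le
  unfold clusterWeight
  positivity

/-- The flow of the censored dynamics through the Edwards-Sokal coupling. -/
lemma gibbs_mul_mswCensored (β : ℝ) (A : Set V) (σ τ : Config V) :
    gibbs G β σ * mswCensored G β A σ τ = ∑ F ∈ G.edgeFinset.powerset, clusterWeight G β F *
      (if F ⊆ agreeEdges G σ ∧ F ⊆ agreeEdges G τ then
        ∏ C : (percGraph F).ConnectedComponent,
          refreshKernel (refreshProb A C.supp) (σ C.out) (τ C.out) else 0) := by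
  rw [mswCensored, Finset.mul_sum]
  refine Finset.sum_subset_zero_on_sdiff (Finset.powerset_mono.2 (agreeEdges_subset G σ)) ?_ ?_
  · intro F hF
    simp only [Finset.mem_sdiff, Finset.mem_powerset] at hF
    simp [hF.2]
  · intro F hF
    have hF := Finset.mem_powerset.1 hF
    have h := isingWeight_mul_percProb G β hF
    by_cases hτ : F ⊆ agreeEdges G τ
    · rw [if_pos ⟨hF, hτ⟩, ← mul_assoc, clusterWeight, ← h, gibbs]
      rw [Finset.prod_congr rfl fun C _ => componentProb_eq_refreshKernel A hF hτ C]
      ring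
    · rw [prod_componentProb_eq_zero A hF hτ, if_neg (fun h => hτ h.2), mul_zero, mul_zero,
        mul_zero]

theorem mswCensored_isReversible (β : ℝ) (A : Set V) :
    IsReversible (gibbs G β) (mswCensored G β A) := by
  intro σ τ
  rw [gibbs_mul_mswCensored, gibbs_mul_mswCensored]
  refine Finset.sum_congr rfl fun F _ => ?_
  congr 1
  simp only [and_comm (a := F ⊆ agreeEdges G σ)]
  refine ite_congr rfl (fun _ => ?_) fun _ => rfl
  exact Finset.prod_congr rfl fun C _ => refreshKernel_comm _ _ _

open Classical in
lemma sum_comp_mk {F : Finset (Sym2 V)} (hF : F ⊆ G.edgeFinset) (H : Config V → ℝ) :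
    ∑ ξ : (percGraph F).ConnectedComponent → Bool,
        H (fun v => ξ ((percGraph F).connectedComponentMk v)) =
      ∑ σ : Config V, if F ⊆ agreeEdges G σ then H σ else 0 := by
  refine Finset.sum_of_injOn
    (fun ξ v => ξ ((percGraph F).connectedComponentMk v)) ?_ ?_ ?_ ?_
  · intro ξ _ ξ' _ h
    funext C
    have := congrFun h C.out
    simpa only [connectedComponentMk_out] using this
  · intro ξ _
    simp
  · intro σ _ hσ
    refine if_neg fun hc => hσ ⟨fun C => σ C.out, by simp, ?_⟩
    funext v
    refine eq_of_reachable hc (SimpleGraph.ConnectedComponent.exact ?_)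
    rw [connectedComponentMk_out]
  · intro ξ _
    rw [if_pos (subset_agreeEdges_comp_mk G hF ξ)]

open Classical in
lemma innerMu_mswCensored_mulVec (β : ℝ) (A : Set V) (f g : Config V → ℝ) :
    innerMu (gibbs G β) ((mswCensored G β A).mulVec f) g =
      ∑ F ∈ G.edgeFinset.powerset, clusterWeight G β F *
        refreshForm (fun C : (percGraph F).ConnectedComponent => refreshProb A C.supp)
          (fun ξ => g fun v => ξ ((percGraph F).connectedComponentMk v))
          (fun ξ => f fun v => ξ ((percGraph F).connectedComponentMk v)) := by
  have h1 : innerMu (gibbs G β) ((mswCensored G β A).mulVec f) g =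
      ∑ σ, ∑ τ, g σ * f τ * (gibbs G β σ * mswCensored G β A σ τ) := by
    simp only [innerMu, Matrix.mulVec, dotProduct]
    refine Finset.sum_congr rfl fun σ _ => ?_
    rw [Finset.mul_sum, Finset.sum_mul]
    exact Finset.sum_congr rfl fun τ _ => by ring
  rw [h1]
  simp only [gibbs_mul_mswCensored, Finset.mul_sum]
  rw [Finset.sum_congr rfl fun σ _ => Finset.sum_comm, Finset.sum_comm]
  refine Finset.sum_congr rfl fun F hF => ?_
  have hF := Finset.mem_powerset.1 hF
  have e : refreshForm (fun C : (percGraph F).ConnectedComponent => refreshProb A C.supp)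
      (fun ξ => g fun v => ξ ((percGraph F).connectedComponentMk v))
      (fun ξ => f fun v => ξ ((percGraph F).connectedComponentMk v)) =
      ∑ ξ : (percGraph F).ConnectedComponent → Bool,
        ∑ ξ' : (percGraph F).ConnectedComponent → Bool,
          g (fun v => ξ ((percGraph F).connectedComponentMk v)) *
            f (fun v => ξ' ((percGraph F).connectedComponentMk v)) *
          ∏ C : (percGraph F).ConnectedComponent, refreshKernel (refreshProb A C.supp)
            (ξ ((percGraph F).connectedComponentMk C.out))
            (ξ' ((percGraph F).connectedComponentMk C.out)) := by
    refine Finset.sum_congr rfl fun ξ _ => Finset.sum_congr rfl fun ξ' _ => ?_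
    congr 1
    exact Finset.prod_congr rfl fun C _ => by rw [connectedComponentMk_out]
  rw [e]
  rw [sum_comp_mk G hF fun σ => ∑ ξ' : (percGraph F).ConnectedComponent → Bool,
    g σ * f (fun v => ξ' ((percGraph F).connectedComponentMk v)) *
      ∏ C : (percGraph F).ConnectedComponent, refreshKernel (refreshProb A C.supp)
        (σ C.out) (ξ' ((percGraph F).connectedComponentMk C.out)), Finset.mul_sum]
  refine Finset.sum_congr rfl fun σ _ => ?_
  rw [sum_comp_mk G hF fun τ => g σ * f τ *
      ∏ C : (percGraph F).ConnectedComponent, refreshKernel (refreshProb A C.supp)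
        (σ C.out) (τ C.out)]
  by_cases hσ : F ⊆ agreeEdges G σ
  · rw [if_pos hσ, Finset.mul_sum]
    refine Finset.sum_congr rfl fun τ _ => ?_
    by_cases hτ : F ⊆ agreeEdges G τ
    · rw [if_pos hτ, if_pos ⟨hσ, hτ⟩]
      ring
    · rw [if_neg hτ, if_neg fun h => hτ h.2]
      ring
  · rw [if_neg hσ]
    simp [hσ]

/-- The comparison inequality for all increasing functions, without positivity. -/
theorem innerMu_msw_le {β : ℝ} (hβ : 0 < β) (A : Set V) {f g : Config V → ℝ} (hf : Monotone f)
    (hg : Monotone g) :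
    innerMu (gibbs G β) ((msw G β).mulVec f) g ≤
      innerMu (gibbs G β) ((mswCensored G β A).mulVec f) g := by
  classical
  rw [msw, innerMu_mswCensored_mulVec, innerMu_mswCensored_mulVec]
  refine Finset.sum_le_sum fun F _ => mul_le_mul_of_nonneg_left ?_ (clusterWeight_nonneg G hβ F)
  have h := refreshForm_le_piecewise
    (α := fun C : (percGraph F).ConnectedComponent => refreshProb Set.univ C.supp)
    (fun _ => refreshProb_nonneg _ _) (fun _ => refreshProb_le_one _ _)
    (g := fun ξ => g fun v => ξ ((percGraph F).connectedComponentMk v))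
    (f := fun ξ => f fun v => ξ ((percGraph F).connectedComponentMk v))
    (fun ξ ξ' hle => hg fun v => hle _) (fun ξ ξ' hle => hf fun v => hle _)
    (Finset.univ.filter fun C => ¬ C.supp ⊆ A)
  refine h.trans_eq ?_
  congr 1
  funext C
  by_cases hC : C.supp ⊆ A <;> simp [refreshProb, Finset.piecewise, hC]

/-! ### Support of the transition matrices -/

variable {G} in
lemma stepMap_of_forall_notMem {A : Set V} [DecidablePred (· ∈ A)] {ω : Finset (Sym2 V)}
    (h : ∀ e ∈ ω, ∀ v ∈ e, v ∉ A) (s σ : Config V) :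
    stepMap G A ω s σ = fun v => if v ∈ A then s v else σ v := by
  funext v
  have hr : ∀ w, v ∈ A → (percGraph (ω ∩ agreeEdges G σ)).Reachable v w → w = v := by
    intro w hv hw
    rw [SimpleGraph.reachable_iff_reflTransGen] at hw
    rcases Relation.ReflTransGen.cases_head hw with rfl | ⟨x, hx, _⟩
    · rfl
    · exact absurd hv (h _ (percGraph_adj_iff.1 hx).1 v (Sym2.mem_mk_left _ _))
  have hb : ∀ b, (∀ w, (percGraph (ω ∩ agreeEdges G σ)).Reachable v w → w ∈ A ∧ s w = b) ↔
      v ∈ A ∧ s v = b := by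
    intro b
    refine ⟨fun h => h v (.refl _), ?_⟩
    rintro ⟨h1, h2⟩ w hw
    rw [hr w h1 hw]
    exact ⟨h1, h2⟩
  simp only [stepMap, step, hb]
  by_cases hv : v ∈ A <;> cases hs : s v <;> simp [hv]

lemma coinWeight_empty_pos (β : ℝ) : 0 < coinWeight G β ∅ := by
  rw [coinWeight, Finset.card_empty, pow_zero, one_mul]
  positivity

theorem mswCensored_actsOn {β : ℝ} (hβ : 0 < β) (A : Set V) : ActsOn A (mswCensored G β A) := by
  classical
  intro σ τ
  constructor
  · intro h v hv
    obtain ⟨F, -, hF⟩ := Finset.exists_ne_zero_of_sum_ne_zero h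
    have h1 := Finset.prod_ne_zero_iff.1 (right_ne_zero_of_mul hF)
      ((percGraph F).connectedComponentMk v) (Finset.mem_univ _)
    have hC : ¬ ((percGraph F).connectedComponentMk v).supp ⊆ A := fun h => hv (h rfl)
    rw [componentProb, if_neg hC] at h1
    by_contra hne
    exact h1 (if_neg fun h => hne (h v rfl).symm)
  · intro h
    rw [mswCensored_eq]
    have hnn : ∀ (ω : Finset (Sym2 V)) (s : Config V),
        0 ≤ coinWeight G β ω * (1 / 2) ^ Fintype.card V *
          (if stepMap G A ω s σ = τ then (1 : ℝ) else 0) := fun ω s => by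
      have := coinWeight_nonneg G hβ ω
      split_ifs <;> positivity
    refine (Finset.sum_pos' (fun ω _ => Finset.sum_nonneg fun s _ => hnn ω s)
      ⟨∅, Finset.empty_mem_powerset _,
        Finset.sum_pos' (fun s _ => hnn ∅ s) ⟨τ, Finset.mem_univ _, ?_⟩⟩).ne'
    have hs : stepMap G A ∅ τ σ = τ := by
      rw [stepMap_of_forall_notMem (by simp)]
      funext v
      split_ifs with hv
      · rfl
      · exact h v hv
    rw [if_pos hs]
    have := coinWeight_empty_pos G β
    positivity

theorem isCensoring_mswCensored {β : ℝ} (hβ : 0 < β) :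
    IsCensoring (gibbs G β) (msw G β) (mswCensored G β) where
  stochastic := mswCensored_mem_rowStochastic G hβ
  monotone := mswCensored_isMonotone G hβ
  reversible := mswCensored_isReversible G β
  actsOn := mswCensored_actsOn G hβ
  comparison A _ _ hf hg _ _ := innerMu_msw_le G hβ A hf hg

lemma msw_pos {β : ℝ} (hβ : 0 < β) (σ τ : Config V) : 0 < msw G β σ τ :=
  lt_of_le_of_ne (Matrix.nonneg_of_mem_rowStochastic (mswCensored_mem_rowStochastic G hβ _))
    ((mswCensored_actsOn G hβ Set.univ σ τ).2 fun v hv => absurd (Set.mem_univ v) hv).symm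

theorem isErgodic_msw {β : ℝ} (hβ : 0 < β) : IsErgodic (msw G β) where
  stochastic := mswCensored_mem_rowStochastic G hβ _
  irreducible := by
    rw [Matrix.isIrreducible_iff_exists_pow_pos fun σ τ => (msw_pos G hβ σ τ).le]
    exact fun σ τ => ⟨1, one_pos, by simpa using msw_pos G hβ σ τ⟩
  aperiodic σ k h := Nat.dvd_one.1 (h 1 le_rfl (by simpa using msw_pos G hβ σ σ))

end Reversible

/-! ### Decay of influence in the Ising model with external fields -/

section Field

/-- The log-likelihood ratio that a vertex with log-likelihood ratio `x` transmits along an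
edge. -/
def edgeMessage (β x : ℝ) : ℝ :=
  Real.log (Real.exp β * Real.exp x + Real.exp (-β)) -
    Real.log (Real.exp (-β) * Real.exp x + Real.exp β)

lemma tanh_nonneg_of_nonneg {β : ℝ} (hβ : 0 ≤ β) : 0 ≤ Real.tanh β := by
  rw [Real.tanh_eq_sinh_div_cosh]
  exact div_nonneg (Real.sinh_nonneg_iff.2 hβ) (Real.cosh_pos β).le

lemma abs_edgeMessage_sub_le {β : ℝ} (hβ : 0 ≤ β) (x y : ℝ) :
    |edgeMessage β x - edgeMessage β y| ≤ Real.tanh β * |x - y| := by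
  set a := Real.exp β with ha
  set b := Real.exp (-β) with hb
  have hab : a * b = 1 := by rw [ha, hb, ← Real.exp_add]; simp
  have ha0 : 0 < a := Real.exp_pos _
  have hb0 : 0 < b := Real.exp_pos _
  have hba : b ≤ a := Real.exp_le_exp.2 (by linarith)
  have htanh : Real.tanh β = (a - b) / (a + b) := by
    rw [Real.tanh_eq_sinh_div_cosh, Real.sinh_eq, Real.cosh_eq, ← ha, ← hb]
    field_simp
  have hder : ∀ z : ℝ, HasDerivAt (edgeMessage β)
      (a * Real.exp z / (a * Real.exp z + b) - b * Real.exp z / (b * Real.exp z + a)) z := by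
    intro z
    have h1 := (((Real.hasDerivAt_exp z).const_mul a).add_const b).log (by positivity)
    have h2 := (((Real.hasDerivAt_exp z).const_mul b).add_const a).log (by positivity)
    exact h1.sub h2
  have hbound : ∀ z : ℝ, ‖a * Real.exp z / (a * Real.exp z + b) -
      b * Real.exp z / (b * Real.exp z + a)‖ ≤ Real.tanh β := by
    intro z
    have hz := Real.exp_pos z
    set X := Real.exp z
    have e : a * X / (a * X + b) - b * X / (b * X + a) =
        X * (a - b) * (a + b) / ((a * X + b) * (b * X + a)) := by
      field_simp
      ring
    rw [e, Real.norm_of_nonneg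
      (div_nonneg (mul_nonneg (mul_nonneg hz.le (by linarith)) (by positivity)) (by positivity)),
      htanh, div_le_div_iff₀ (by positivity) (by positivity)]
    have h3 : X * (a + b) * (a + b) ≤ (a * X + b) * (b * X + a) := by
      have : (a * X + b) * (b * X + a) - X * (a + b) * (a + b) = (a * b) * (X - 1) ^ 2 := by ring
      nlinarith [sq_nonneg (X - 1)]
    calc X * (a - b) * (a + b) * (a + b) = (a - b) * (X * (a + b) * (a + b)) := by ring
      _ ≤ (a - b) * ((a * X + b) * (b * X + a)) :=
        mul_le_mul_of_nonneg_left h3 (by linarith)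
  have := convex_univ.norm_image_sub_le_of_norm_hasDerivWithin_le
    (fun z _ => (hder z).hasDerivWithinAt) (fun z _ => hbound z) (Set.mem_univ y) (Set.mem_univ x)
  simpa [Real.norm_eq_abs] using this

variable {V : Type*} [Fintype V] [DecidableEq V] (G : SimpleGraph V) [DecidableRel G.Adj]

/-- Minus the energy of `τ` in the Ising model on the subgraph induced on `Λ`, with external
fields `h`. -/
def fieldEnergy (β : ℝ) (Λ : Finset V) (h : V → ℝ) (τ : Config V) : ℝ :=
  β / 2 * ∑ x ∈ Λ, ∑ y ∈ Λ, (if G.Adj x y then spin (τ x) * spin (τ y) else 0) +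
    ∑ x, h x * spin (τ x)

/-- The partition function. -/
def fieldSum (β : ℝ) (Λ : Finset V) (h : V → ℝ) : ℝ :=
  ∑ τ : Config V, Real.exp (fieldEnergy G β Λ h τ)

/-- The part of the partition function where `v` has the spin `b`. -/
def fieldSumAt (β : ℝ) (Λ : Finset V) (h : V → ℝ) (v : V) (b : Bool) : ℝ :=
  ∑ τ : Config V, if τ v = b then Real.exp (fieldEnergy G β Λ h τ) else 0

/-- The log-likelihood ratio of the spin of `v`. -/
def logRatio (β : ℝ) (Λ : Finset V) (h : V → ℝ) (v : V) : ℝ :=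
  Real.log (fieldSumAt G β Λ h v true) - Real.log (fieldSumAt G β Λ h v false)

/-- The field equal to `a` on `N` and to zero elsewhere. -/
def bump (N : Finset V) (a : ℝ) : V → ℝ := fun x => if x ∈ N then a else 0

lemma fieldSum_pos (β : ℝ) (Λ : Finset V) (h : V → ℝ) : 0 < fieldSum G β Λ h :=
  Finset.sum_pos (fun _ _ => Real.exp_pos _) Finset.univ_nonempty

lemma fieldSumAt_pos (β : ℝ) (Λ : Finset V) (h : V → ℝ) (v : V) (b : Bool) :
    0 < fieldSumAt G β Λ h v b := by
  refine Finset.sum_pos' (fun τ _ => ?_) ⟨fun _ => b, Finset.mem_univ _, ?_⟩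
  · split_ifs
    exacts [(Real.exp_pos _).le, le_rfl]
  · rw [if_pos rfl]
    exact Real.exp_pos _

omit [DecidableEq V] in
lemma fieldEnergy_add (β : ℝ) (Λ : Finset V) (h k : V → ℝ) (τ : Config V) :
    fieldEnergy G β Λ (h + k) τ = fieldEnergy G β Λ h τ + ∑ x, k x * spin (τ x) := by
  simp only [fieldEnergy, Pi.add_apply, add_mul, Finset.sum_add_distrib]
  ring

lemma sum_bump_mul (N : Finset V) (a : ℝ) (f : V → ℝ) :
    ∑ x, bump N a x * f x = a * ∑ x ∈ N, f x := by
  simp only [bump, ite_mul, zero_mul, Finset.mul_sum]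
  rw [Finset.sum_ite_mem, Finset.univ_inter]

lemma fieldSum_add_bump_singleton (β : ℝ) (Λ : Finset V) (h : V → ℝ) (w : V) (a : ℝ) :
    fieldSum G β Λ (h + bump {w} a) = Real.exp a * fieldSumAt G β Λ h w true +
      Real.exp (-a) * fieldSumAt G β Λ h w false := by
  rw [fieldSum, fieldSumAt, fieldSumAt, Finset.mul_sum, Finset.mul_sum, ← Finset.sum_add_distrib]
  refine Finset.sum_congr rfl fun τ _ => ?_
  rw [fieldEnergy_add, sum_bump_mul, Finset.sum_singleton, Real.exp_add]
  cases τ w <;> simp [spin, mul_comm]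

lemma log_fieldSum_sub (β : ℝ) (Λ : Finset V) (h : V → ℝ) (w : V) :
    Real.log (fieldSum G β Λ (h + bump {w} β)) - Real.log (fieldSum G β Λ (h + bump {w} (-β))) =
      edgeMessage β (logRatio G β Λ h w) := by
  have hp := fieldSumAt_pos G β Λ h w true
  have hm := fieldSumAt_pos G β Λ h w false
  have e : Real.exp (logRatio G β Λ h w) =
      fieldSumAt G β Λ h w true / fieldSumAt G β Λ h w false := by
    rw [logRatio, Real.exp_sub, Real.exp_log hp, Real.exp_log hm]
  rw [fieldSum_add_bump_singleton, fieldSum_add_bump_singleton, edgeMessage, e, neg_neg]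
  have key : ∀ s t : ℝ, 0 < s → 0 < t →
      s * fieldSumAt G β Λ h w true + t * fieldSumAt G β Λ h w false =
      (s * (fieldSumAt G β Λ h w true / fieldSumAt G β Λ h w false) + t) *
        fieldSumAt G β Λ h w false := by
    intro s t _ _
    field_simp
  have h1 := Real.exp_pos β
  have h2 := Real.exp_pos (-β)
  rw [key _ _ h1 h2, key _ _ h2 h1, Real.log_mul (by positivity) hm.ne',
    Real.log_mul (by positivity) hm.ne']
  ring

omit [Fintype V] in
lemma bump_insert {N : Finset V} {w : V} (hw : w ∉ N) (a : ℝ) :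
    bump (insert w N) a = bump {w} a + bump N a := by
  funext x
  simp only [bump, Pi.add_apply, Finset.mem_insert, Finset.mem_singleton]
  by_cases hx : x = w
  · subst hx
    simp [hw]
  · simp [hx]

/-- `c` bounds the influence of the external fields on the log-likelihood ratio of `v`. -/
def IsInfluenceBound (β : ℝ) (Λ : Finset V) (v : V) (c : V → ℝ) : Prop :=
  ∀ h h' : V → ℝ, |logRatio G β Λ h v - logRatio G β Λ h' v| ≤ ∑ x, c x * |h x - h' x|

lemma abs_log_fieldSum_sub_le {β : ℝ} (hβ : 0 ≤ β) (Λ N : Finset V) (c : V → V → ℝ)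
    (hc : ∀ w ∈ N, IsInfluenceBound G β Λ w (c w)) (h h' : V → ℝ) :
    |(Real.log (fieldSum G β Λ (h + bump N β)) - Real.log (fieldSum G β Λ (h + bump N (-β)))) -
      (Real.log (fieldSum G β Λ (h' + bump N β)) -
        Real.log (fieldSum G β Λ (h' + bump N (-β))))| ≤
      Real.tanh β * ∑ w ∈ N, ∑ x, c w x * |h x - h' x| := by
  induction N using Finset.induction_on generalizing h h' with
  | empty =>
    have : ∀ a, bump (∅ : Finset V) a = 0 := fun a => by funext x; simp [bump]
    simp [this]
  | insert w N hw ih =>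
    have hsplit : ∀ k : V → ℝ,
        Real.log (fieldSum G β Λ (k + bump (insert w N) β)) -
          Real.log (fieldSum G β Λ (k + bump (insert w N) (-β))) =
        (Real.log (fieldSum G β Λ (k + bump {w} β + bump N β)) -
          Real.log (fieldSum G β Λ (k + bump {w} β + bump N (-β)))) +
        edgeMessage β (logRatio G β Λ (k + bump N (-β)) w) := by
      intro k
      rw [← log_fieldSum_sub, bump_insert hw, bump_insert hw, ← add_assoc, ← add_assoc,
        add_right_comm k (bump N (-β)) (bump {w} β),
        add_right_comm k (bump N (-β)) (bump {w} (-β))]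
      ring
    rw [hsplit, hsplit, Finset.sum_insert hw, mul_add]
    have h1 := ih (fun x hx => hc x (Finset.mem_insert_of_mem hx)) (h + bump {w} β)
      (h' + bump {w} β)
    have h2 := (abs_edgeMessage_sub_le hβ (logRatio G β Λ (h + bump N (-β)) w)
      (logRatio G β Λ (h' + bump N (-β)) w)).trans (mul_le_mul_of_nonneg_left
        (hc w (Finset.mem_insert_self w N) (h + bump N (-β)) (h' + bump N (-β)))
        (tanh_nonneg_of_nonneg hβ))
    simp only [Pi.add_apply, add_sub_add_right_eq_sub] at h1 h2
    rw [add_sub_add_comm, add_comm (Real.tanh β * _)]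
    exact (abs_add_le _ _).trans (add_le_add h1 h2)

/-- The neighbours of `v` in `Λ`. -/
def nbrsIn (Λ : Finset V) (v : V) : Finset V := (Λ.erase v).filter fun x => G.Adj v x

lemma fieldEnergy_erase (β : ℝ) {Λ : Finset V} {v : V} (hv : v ∈ Λ) (h : V → ℝ) (τ : Config V) :
    fieldEnergy G β Λ h τ = h v * spin (τ v) +
      fieldEnergy G β (Λ.erase v)
        (Function.update h v 0 + bump (nbrsIn G Λ v) (spin (τ v) * β)) τ := by
  rw [fieldEnergy_add, sum_bump_mul]
  simp only [fieldEnergy]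
  have h1 : ∑ x, h x * spin (τ x) = h v * spin (τ v) +
      ∑ x, Function.update h v 0 x * spin (τ x) := by
    rw [← Finset.add_sum_erase _ _ (Finset.mem_univ v),
      ← Finset.add_sum_erase _ (fun x => Function.update h v 0 x * spin (τ x)) (Finset.mem_univ v),
      Function.update_self, zero_mul, zero_add]
    congr 1
    refine Finset.sum_congr rfl fun x hx => ?_
    rw [Function.update_of_ne (Finset.ne_of_mem_erase hx)]
  have h2 : ∑ x ∈ Λ, ∑ y ∈ Λ, (if G.Adj x y then spin (τ x) * spin (τ y) else 0) =
      ∑ x ∈ Λ.erase v, ∑ y ∈ Λ.erase v, (if G.Adj x y then spin (τ x) * spin (τ y) else 0) +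
        2 * (spin (τ v) * ∑ x ∈ nbrsIn G Λ v, spin (τ x)) := by
    have h3 : ∀ x, ∑ y ∈ Λ, (if G.Adj x y then spin (τ x) * spin (τ y) else 0) =
        (if G.Adj x v then spin (τ x) * spin (τ v) else 0) +
          ∑ y ∈ Λ.erase v, (if G.Adj x y then spin (τ x) * spin (τ y) else 0) := fun x =>
      (Finset.add_sum_erase _ _ hv).symm
    rw [← Finset.add_sum_erase _ _ hv, Finset.sum_congr rfl fun x _ => h3 x, h3 v,
      Finset.sum_add_distrib, if_neg (G.irrefl (v := v))]
    have h4 : ∑ y ∈ Λ.erase v, (if G.Adj v y then spin (τ v) * spin (τ y) else 0) =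
        spin (τ v) * ∑ x ∈ nbrsIn G Λ v, spin (τ x) := by
      rw [nbrsIn, Finset.mul_sum, Finset.sum_filter]
    have h5 : ∑ y ∈ Λ.erase v, (if G.Adj y v then spin (τ y) * spin (τ v) else 0) =
        spin (τ v) * ∑ x ∈ nbrsIn G Λ v, spin (τ x) := by
      rw [← h4]
      refine Finset.sum_congr rfl fun y _ => ?_
      simp only [G.adj_comm y v, mul_comm]
    rw [h4, h5]
    ring
  rw [h1, h2]
  ring

lemma fieldEnergy_update (β : ℝ) {Λ : Finset V} {v : V} (hv : v ∉ Λ) {h : V → ℝ} (hh : h v = 0)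
    (τ : Config V) (b : Bool) :
    fieldEnergy G β Λ h (Function.update τ v b) = fieldEnergy G β Λ h τ := by
  have hne : ∀ x ∈ Λ, Function.update τ v b x = τ x := fun x hx =>
    Function.update_of_ne (ne_of_mem_of_not_mem hx hv) _ _
  simp only [fieldEnergy]
  congr 1
  · congr 1
    refine Finset.sum_congr rfl fun x hx => Finset.sum_congr rfl fun y hy => ?_
    rw [hne x hx, hne y hy]
  · refine Finset.sum_congr rfl fun x _ => ?_
    by_cases hx : x = v
    · rw [hx, hh, zero_mul, zero_mul]
    · rw [Function.update_of_ne hx]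

lemma two_mul_fieldSumAt (β : ℝ) {Λ : Finset V} {v : V} (hv : v ∈ Λ) (h : V → ℝ) (b : Bool) :
    2 * fieldSumAt G β Λ h v b = Real.exp (h v * spin b) *
      fieldSum G β (Λ.erase v) (Function.update h v 0 + bump (nbrsIn G Λ v) (spin b * β)) := by
  rw [fieldSumAt, ← sum_update_true_add_false v, fieldSum, Finset.mul_sum]
  refine Finset.sum_congr rfl fun τ _ => ?_
  have hz : (Function.update h v 0 + bump (nbrsIn G Λ v) (spin b * β)) v = 0 := by
    simp [bump, nbrsIn]
  have hb : Real.exp (fieldEnergy G β Λ h (Function.update τ v b)) = Real.exp (h v * spin b) *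
      Real.exp (fieldEnergy G β (Λ.erase v)
        (Function.update h v 0 + bump (nbrsIn G Λ v) (spin b * β)) τ) := by
    rw [fieldEnergy_erase G β hv, Function.update_self, Real.exp_add,
      fieldEnergy_update G β (Finset.notMem_erase v Λ) hz]
  rw [← hb]
  cases b <;> simp

lemma logRatio_eq (β : ℝ) {Λ : Finset V} {v : V} (hv : v ∈ Λ) (h : V → ℝ) :
    logRatio G β Λ h v = 2 * h v +
      (Real.log (fieldSum G β (Λ.erase v) (Function.update h v 0 + bump (nbrsIn G Λ v) β)) -
      Real.log (fieldSum G β (Λ.erase v)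
        (Function.update h v 0 + bump (nbrsIn G Λ v) (-β)))) := by
  have h1 := two_mul_fieldSumAt G β hv h true
  have h2 := two_mul_fieldSumAt G β hv h false
  have p1 := fieldSumAt_pos G β Λ h v true
  have p2 := fieldSumAt_pos G β Λ h v false
  have l1 := congrArg Real.log h1
  have l2 := congrArg Real.log h2
  rw [Real.log_mul two_ne_zero p1.ne', Real.log_mul (Real.exp_ne_zero _) (fieldSum_pos G _ _ _).ne',
    Real.log_exp] at l1
  rw [Real.log_mul two_ne_zero p2.ne', Real.log_mul (Real.exp_ne_zero _) (fieldSum_pos G _ _ _).ne',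
    Real.log_exp] at l2
  simp only [spin, if_true, Bool.false_eq_true, if_false, one_mul, mul_one, neg_one_mul] at l1 l2
  rw [logRatio]
  linarith

/-- The influence on `v` is controlled by the influences on its neighbours once `v` is
removed. -/
lemma isInfluenceBound_of_erase {β : ℝ} (hβ : 0 ≤ β) {Λ : Finset V} {v : V} (hv : v ∈ Λ)
    (c : V → V → ℝ) (hc0 : ∀ w ∈ nbrsIn G Λ v, ∀ x, 0 ≤ c w x)
    (hc : ∀ w ∈ nbrsIn G Λ v, IsInfluenceBound G β (Λ.erase v) w (c w)) :
    IsInfluenceBound G β Λ v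
      (fun x => bump {v} 2 x + Real.tanh β * ∑ w ∈ nbrsIn G Λ v, c w x) := by
  intro h h'
  have hθ := tanh_nonneg_of_nonneg hβ
  rw [logRatio_eq G β hv, logRatio_eq G β hv, add_sub_add_comm, ← mul_sub]
  have h1 := abs_log_fieldSum_sub_le G hβ (Λ.erase v) (nbrsIn G Λ v) c hc
    (Function.update h v 0) (Function.update h' v 0)
  have h2 : ∑ w ∈ nbrsIn G Λ v, ∑ x, c w x *
      |Function.update h v 0 x - Function.update h' v 0 x| ≤
      ∑ w ∈ nbrsIn G Λ v, ∑ x, c w x * |h x - h' x| := by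
    refine Finset.sum_le_sum fun w hw => Finset.sum_le_sum fun x _ =>
      mul_le_mul_of_nonneg_left ?_ (hc0 w hw x)
    by_cases hx : x = v
    · subst hx
      simp
    · rw [Function.update_of_ne hx, Function.update_of_ne hx]
  refine (abs_add_le _ _).trans ((add_le_add le_rfl
    (h1.trans (mul_le_mul_of_nonneg_left h2 hθ))).trans_eq ?_)
  simp only [add_mul, Finset.sum_add_distrib, sum_bump_mul, Finset.sum_singleton, abs_mul,
    abs_two, mul_assoc, Finset.sum_mul, Finset.mul_sum]
  congr 1
  rw [Finset.sum_comm]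

/-- The ball of radius `k` around `v`. -/
def ball (v : V) : ℕ → Finset V
  | 0 => {v}
  | k + 1 => ball v k ∪ (ball v k).biUnion fun x => G.neighborFinset x

lemma ball_subset_succ (v : V) (k : ℕ) : ball G v k ⊆ ball G v (k + 1) :=
  Finset.subset_union_left

lemma ball_mono (v : V) : Monotone (ball G v) := monotone_nat_of_le_succ (ball_subset_succ G v)

variable {G} in
lemma mem_ball_succ_of_adj {v x y : V} {k : ℕ} (hx : x ∈ ball G v k) (h : G.Adj x y) :
    y ∈ ball G v (k + 1) :=
  Finset.mem_union_right _ (Finset.mem_biUnion.2 ⟨x, hx, by simpa using h⟩)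

lemma mem_ball_self (v : V) (k : ℕ) : v ∈ ball G v k :=
  ball_mono G v (Nat.zero_le k) (Finset.mem_singleton_self v)

variable {G} in
lemma card_ball_le {d : ℕ} (hd : ∀ v, G.degree v ≤ d) (v : V) (k : ℕ) :
    (ball G v k).card ≤ (d + 1) ^ k := by
  induction k with
  | zero => simp [ball]
  | succ k ih =>
    calc (ball G v (k + 1)).card ≤ (ball G v k).card + (ball G v k).card * d :=
          (Finset.card_union_le _ _).trans
            (Nat.add_le_add_left (Finset.card_biUnion_le_card_mul _ _ _ fun x _ => hd x) _)
      _ = (ball G v k).card * (d + 1) := by ring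
      _ ≤ (d + 1) ^ k * (d + 1) := Nat.mul_le_mul_right _ ih
      _ = (d + 1) ^ (k + 1) := (pow_succ _ _).symm

variable {G}

lemma nbrsIn_subset (Λ : Finset V) (v : V) : nbrsIn G Λ v ⊆ G.neighborFinset v := by
  intro x hx
  simpa using (Finset.mem_filter.1 hx).2

lemma card_nbrsIn_erase_lt {d : ℕ} (hd : ∀ v, G.degree v ≤ d + 1) (Λ : Finset V) {v w : V}
    (hw : w ∈ nbrsIn G Λ v) : (nbrsIn G (Λ.erase v) w).card ≤ d := by
  have hadj : G.Adj v w := (Finset.mem_filter.1 hw).2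
  have hsub : nbrsIn G (Λ.erase v) w ⊆ (G.neighborFinset w).erase v := by
    intro x hx
    refine Finset.mem_erase.2 ⟨?_, nbrsIn_subset _ _ hx⟩
    rintro rfl
    simp [nbrsIn] at hx
  have h1 := Finset.card_le_card hsub
  rw [Finset.card_erase_of_mem (by simpa using hadj.symm), G.card_neighborFinset_eq_degree] at h1
  have := hd w
  omega

omit [Fintype V] [DecidableEq V] in
lemma sum_sum_nbrsIn_le {θ M : ℝ} (hθ : 0 ≤ θ) {N : Finset V} {d : ℕ} (hN : N.card ≤ d)
    (hM : 0 ≤ M) (S : Finset V) (c : V → V → ℝ) (hc : ∀ w ∈ N, ∑ x ∈ S, c w x ≤ M) :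
    ∑ x ∈ S, θ * ∑ w ∈ N, c w x ≤ θ * (d * M) := by
  rw [← Finset.mul_sum, Finset.sum_comm]
  refine mul_le_mul_of_nonneg_left ?_ hθ
  calc ∑ w ∈ N, ∑ x ∈ S, c w x ≤ ∑ _w ∈ N, M := Finset.sum_le_sum hc
    _ = N.card * M := by rw [Finset.sum_const, nsmul_eq_mul]
    _ ≤ d * M := mul_le_mul_of_nonneg_right (by exact_mod_cast hN) hM

/-- The total influence of the fields outside a ball decays exponentially with the distance, if
the vertex has a neighbour that has been removed. -/
lemma exists_isInfluenceBound_of_card_le {β : ℝ} (hβ : 0 ≤ β) {d : ℕ}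
    (hd : ∀ v, G.degree v ≤ d + 1) (hκ : d * Real.tanh β < 1) (v₀ : V) (R : ℕ) (Λ : Finset V) :
    ∀ (j : ℕ) (v : V), v ∈ Λ → v ∈ ball G v₀ j → (nbrsIn G Λ v).card ≤ d →
      ∃ c : V → ℝ, (∀ x, 0 ≤ c x) ∧ IsInfluenceBound G β Λ v c ∧
        ∑ x ∈ (ball G v₀ R)ᶜ, c x ≤
          2 / (1 - d * Real.tanh β) * (d * Real.tanh β) ^ (R + 1 - j) := by
  have hθ := tanh_nonneg_of_nonneg hβ
  set κ := d * Real.tanh β with hκdef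
  have hκ0 : 0 ≤ κ := by positivity
  have hC : 0 ≤ 2 / (1 - κ) := div_nonneg zero_le_two (by linarith)
  induction Λ using Finset.strongInduction with
  | H Λ ih =>
    intro j v hv hj hcard
    have hex : ∀ w, ∃ c : V → ℝ, w ∈ nbrsIn G Λ v → (∀ x, 0 ≤ c x) ∧
        IsInfluenceBound G β (Λ.erase v) w c ∧
        ∑ x ∈ (ball G v₀ R)ᶜ, c x ≤ 2 / (1 - κ) * κ ^ (R + 1 - (j + 1)) := by
      intro w
      by_cases hw : w ∈ nbrsIn G Λ v
      · obtain ⟨c, h⟩ := ih (Λ.erase v) (Finset.erase_ssubset hv) (j + 1) w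
          (Finset.mem_filter.1 hw).1 (mem_ball_succ_of_adj hj (Finset.mem_filter.1 hw).2)
          (card_nbrsIn_erase_lt hd Λ hw)
        exact ⟨c, fun _ => h⟩
      · exact ⟨0, fun h => absurd h hw⟩
    choose c hc using hex
    refine ⟨_, fun x => ?_, isInfluenceBound_of_erase G hβ hv c (fun w hw => (hc w hw).1)
      (fun w hw => (hc w hw).2.1), ?_⟩
    · refine add_nonneg ?_ (mul_nonneg hθ (Finset.sum_nonneg fun w hw => (hc w hw).1 x))
      unfold bump
      split_ifs <;> norm_num
    · rw [Finset.sum_add_distrib]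
      have h1 := sum_sum_nbrsIn_le hθ hcard (mul_nonneg hC (pow_nonneg hκ0 _)) (ball G v₀ R)ᶜ c
        (fun w hw => (hc w hw).2.2)
      have h2 : Real.tanh β * (d * (2 / (1 - κ) * κ ^ (R + 1 - (j + 1)))) =
          κ * (2 / (1 - κ) * κ ^ (R + 1 - (j + 1))) := by
        rw [hκdef]
        ring
      rw [h2] at h1
      have h3 : ∑ x ∈ (ball G v₀ R)ᶜ, bump {v} 2 x = if v ∈ ball G v₀ R then 0 else 2 := by
        simp only [bump, Finset.mem_singleton, Finset.sum_ite_eq', Finset.mem_compl]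
        split_ifs <;> rfl
      rw [h3]
      rcases Nat.lt_or_ge R j with hjR | hjR
      · have e1 : R + 1 - j = 0 := by omega
        have e2 : R + 1 - (j + 1) = 0 := by omega
        rw [e2, pow_zero, mul_one] at h1
        rw [e1, pow_zero, mul_one]
        have h4 : 2 + κ * (2 / (1 - κ)) = 2 / (1 - κ) := by
          have : 1 - κ ≠ 0 := by linarith
          field_simp
          ring
        split_ifs <;> linarith
      · have e1 : R + 1 - j = R + 1 - (j + 1) + 1 := by omega
        rw [if_pos (ball_mono G v₀ hjR hj), zero_add, e1, pow_succ]
        linarith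

lemma exists_isInfluenceBound {β : ℝ} (hβ : 0 ≤ β) {d : ℕ} (hd1 : 1 ≤ d)
    (hd : ∀ v, G.degree v ≤ d + 1) (hκ : d * Real.tanh β < 1) (v : V) (R : ℕ) (Λ : Finset V)
    (hv : v ∈ Λ) :
    ∃ c : V → ℝ, (∀ x, 0 ≤ c x) ∧ IsInfluenceBound G β Λ v c ∧
      ∑ x ∈ (ball G v R)ᶜ, c x ≤
        4 / (1 - d * Real.tanh β) * (d * Real.tanh β) ^ (R + 1) := by
  have hθ := tanh_nonneg_of_nonneg hβ
  set κ := d * Real.tanh β with hκdef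
  have hκ0 : 0 ≤ κ := by positivity
  have hC : 0 ≤ 2 / (1 - κ) := div_nonneg zero_le_two (by linarith)
  have hex : ∀ w, ∃ c : V → ℝ, w ∈ nbrsIn G Λ v → (∀ x, 0 ≤ c x) ∧
      IsInfluenceBound G β (Λ.erase v) w c ∧
      ∑ x ∈ (ball G v R)ᶜ, c x ≤ 2 / (1 - κ) * κ ^ R := by
    intro w
    by_cases hw : w ∈ nbrsIn G Λ v
    · obtain ⟨c, h⟩ := exists_isInfluenceBound_of_card_le hβ hd hκ v R (Λ.erase v) 1 w
        (Finset.mem_filter.1 hw).1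
        (mem_ball_succ_of_adj (mem_ball_self G v 0) (Finset.mem_filter.1 hw).2)
        (card_nbrsIn_erase_lt hd Λ hw)
      exact ⟨c, fun _ => h⟩
    · exact ⟨0, fun h => absurd h hw⟩
  choose c hc using hex
  refine ⟨_, fun x => ?_, isInfluenceBound_of_erase G hβ hv c (fun w hw => (hc w hw).1)
    (fun w hw => (hc w hw).2.1), ?_⟩
  · refine add_nonneg ?_ (mul_nonneg hθ (Finset.sum_nonneg fun w hw => (hc w hw).1 x))
    unfold bump
    split_ifs <;> norm_num
  · rw [Finset.sum_add_distrib]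
    have hN : (nbrsIn G Λ v).card ≤ 2 * d :=
      ((Finset.card_le_card (nbrsIn_subset Λ v)).trans (hd v)).trans (by omega)
    have h1 := sum_sum_nbrsIn_le hθ hN (mul_nonneg hC (pow_nonneg hκ0 R)) (ball G v R)ᶜ c
      (fun w hw => (hc w hw).2.2)
    have h2 : Real.tanh β * ((2 * d : ℕ) * (2 / (1 - κ) * κ ^ R)) =
        4 / (1 - κ) * κ ^ (R + 1) := by
      rw [pow_succ, hκdef]
      push_cast
      ring
    rw [h2] at h1
    have h3 : ∑ x ∈ (ball G v R)ᶜ, bump {v} 2 x = 0 := by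
      refine Finset.sum_eq_zero fun x hx => if_neg fun hxv => ?_
      rw [Finset.mem_singleton.1 hxv] at hx
      exact Finset.mem_compl.1 hx (mem_ball_self G v R)
    rw [h3, zero_add]
    exact h1

end Field

/-! ### Local convergence of the censored dynamics -/

section Local

variable {V : Type*} [Fintype V] [DecidableEq V] (G : SimpleGraph V) [DecidableRel G.Adj]

/-- The indicator of the spin `+` at `v`. -/
def plusInd (v : V) (σ : Config V) : ℝ := if σ v then 1 else 0

lemma sum_sum_adj_edgeSpin (τ : Config V) :
    ∑ x, ∑ y, (if G.Adj x y then spin (τ x) * spin (τ y) else 0) =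
      2 * ∑ e ∈ G.edgeFinset, edgeSpin τ e := by
  rw [← Finset.sum_product', ← Finset.sum_filter]
  set S := (Finset.univ ×ˢ Finset.univ : Finset (V × V)).filter fun p => G.Adj p.1 p.2 with hS
  have hmaps : ∀ p ∈ S, Sym2.mk p.1 p.2 ∈ G.edgeFinset := by
    rintro ⟨x, y⟩ hp
    simpa [hS] using hp
  rw [← Finset.sum_fiberwise_of_maps_to hmaps, Finset.mul_sum]
  refine Finset.sum_congr rfl fun e he => ?_
  induction e using Sym2.ind with
  | h u v =>
    have hadj : G.Adj u v := by simpa using he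
    have hfib : S.filter (fun p => Sym2.mk p.1 p.2 = s(u, v)) = {(u, v), (v, u)} := by
      ext ⟨x, y⟩
      simp only [hS, Finset.mem_filter, Finset.mem_product, Finset.mem_univ, true_and, Sym2.eq_iff,
        Finset.mem_insert, Finset.mem_singleton, Prod.mk.injEq]
      constructor
      · exact fun h => h.2
      · rintro (⟨rfl, rfl⟩ | ⟨rfl, rfl⟩)
        exacts [⟨hadj, .inl ⟨rfl, rfl⟩⟩, ⟨hadj.symm, .inr ⟨rfl, rfl⟩⟩]
    rw [hfib, Finset.sum_pair (by simp [hadj.ne])]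
    simp only [edgeSpin, Sym2.lift_mk]
    ring

/-- The field exerted on `B` by the spins of `σ` outside of `B`. -/
def boundaryField (β : ℝ) (B : Finset V) (σ : Config V) : V → ℝ := fun x =>
  if x ∈ B then β * ∑ y ∈ Bᶜ, (if G.Adj x y then spin (σ y) else 0) else 0

lemma exists_isingWeight_piecewise (β : ℝ) (B : Finset V) (σ : Config V) :
    ∃ K : ℝ, 0 < K ∧ ∀ τ : Config V, isingWeight G β (B.piecewise τ σ) =
      Real.exp (fieldEnergy G β B (boundaryField G β B σ) τ) * K := by
  refine ⟨Real.exp (β / 2 * ∑ x ∈ Bᶜ, ∑ y ∈ Bᶜ,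
    (if G.Adj x y then spin (σ x) * spin (σ y) else 0)), Real.exp_pos _, fun τ => ?_⟩
  rw [isingWeight, ← Real.exp_add]
  congr 1
  have h1 := sum_sum_adj_edgeSpin G (B.piecewise τ σ)
  have hB : ∀ x ∈ B, B.piecewise τ σ x = τ x := fun x hx => Finset.piecewise_eq_of_mem _ _ _ hx
  have hBc : ∀ x ∈ Bᶜ, B.piecewise τ σ x = σ x := fun x hx =>
    Finset.piecewise_eq_of_notMem _ _ _ (Finset.mem_compl.1 hx)
  set cross := ∑ x ∈ B, ∑ y ∈ Bᶜ, (if G.Adj x y then spin (τ x) * spin (σ y) else 0) with hcross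
  have h2 : ∑ x, ∑ y, (if G.Adj x y then
      spin (B.piecewise τ σ x) * spin (B.piecewise τ σ y) else 0) =
      ∑ x ∈ B, ∑ y ∈ B, (if G.Adj x y then spin (τ x) * spin (τ y) else 0) + 2 * cross +
      ∑ x ∈ Bᶜ, ∑ y ∈ Bᶜ, (if G.Adj x y then spin (σ x) * spin (σ y) else 0) := by
    have hin : ∀ x, ∑ y, (if G.Adj x y then
        spin (B.piecewise τ σ x) * spin (B.piecewise τ σ y) else 0) =
        ∑ y ∈ B, (if G.Adj x y then spin (B.piecewise τ σ x) * spin (τ y) else 0) +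
        ∑ y ∈ Bᶜ, (if G.Adj x y then spin (B.piecewise τ σ x) * spin (σ y) else 0) := by
      intro x
      rw [← Finset.sum_add_sum_compl B]
      exact congrArg₂ _ (Finset.sum_congr rfl fun y hy => by rw [hB y hy])
        (Finset.sum_congr rfl fun y hy => by rw [hBc y hy])
    have hc : ∑ x ∈ Bᶜ, ∑ y ∈ B, (if G.Adj x y then spin (σ x) * spin (τ y) else 0) = cross := by
      rw [hcross, Finset.sum_comm]
      refine Finset.sum_congr rfl fun x _ => Finset.sum_congr rfl fun y _ => ?_
      simp only [G.adj_comm y x, mul_comm]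
    rw [Finset.sum_congr rfl fun x _ => hin x, ← Finset.sum_add_sum_compl B,
      Finset.sum_congr (s₁ := B) rfl fun x hx => by rw [hB x hx],
      Finset.sum_congr (s₁ := Bᶜ) rfl fun x hx => by rw [hBc x hx],
      Finset.sum_add_distrib, Finset.sum_add_distrib, hc]
    ring
  have h3 : ∑ x, boundaryField G β B σ x * spin (τ x) = β * cross := by
    simp only [boundaryField, ite_mul, zero_mul]
    rw [Finset.sum_ite_mem, Finset.univ_inter, hcross, Finset.mul_sum]
    refine Finset.sum_congr rfl fun x _ => ?_
    rw [mul_assoc, Finset.sum_mul]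
    congr 1
    refine Finset.sum_congr rfl fun y _ => ?_
    split_ifs
    · ring
    · ring
  rw [fieldEnergy, h3]
  linear_combination (-β / 2) * h1 + (β / 2) * h2

/-- `σ` and `τ` agree off `B`. -/
def AgreeOff (B : Finset V) (σ τ : Config V) : Prop := ∀ v, v ∉ B → σ v = τ v

omit [Fintype V] [DecidableEq V] in
lemma AgreeOff.refl (B : Finset V) (σ : Config V) : AgreeOff B σ σ := fun _ _ => rfl

omit [Fintype V] [DecidableEq V] in
lemma AgreeOff.symm {B : Finset V} {σ τ : Config V} (h : AgreeOff B σ τ) : AgreeOff B τ σ :=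
  fun v hv => (h v hv).symm

omit [Fintype V] [DecidableEq V] in
lemma AgreeOff.trans {B : Finset V} {σ τ ρ : Config V} (h : AgreeOff B σ τ)
    (h' : AgreeOff B τ ρ) : AgreeOff B σ ρ :=
  fun v hv => (h v hv).trans (h' v hv)

instance (B : Finset V) (σ τ : Config V) : Decidable (AgreeOff B σ τ) :=
  inferInstanceAs (Decidable (∀ v, v ∉ B → σ v = τ v))

lemma exists_sum_piecewise (B : Finset V) (σ : Config V) :
    ∃ N : ℝ, 0 < N ∧ ∀ H : Config V → ℝ, ∑ τ, H (B.piecewise τ σ) =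
      N * ∑ τ, if AgreeOff B σ τ then H τ else 0 := by
  refine ⟨((Finset.univ.filter fun τ : Config V => ∀ v ∈ B, τ v = σ v).card : ℝ), ?_, fun H => ?_⟩
  · exact_mod_cast Finset.card_pos.2 ⟨σ, by simp⟩
  have h1 : ∀ τ, H (B.piecewise τ σ) = ∑ ρ, if B.piecewise τ σ = ρ then H ρ else 0 := by
    intro τ
    simp
  rw [Finset.sum_congr rfl fun τ _ => h1 τ, Finset.sum_comm, Finset.mul_sum]
  refine Finset.sum_congr rfl fun ρ _ => ?_
  by_cases hρ : AgreeOff B σ ρ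
  · rw [if_pos hρ, ← Finset.sum_filter, Finset.sum_const, nsmul_eq_mul]
    congr 2
    refine Finset.card_bij' (fun τ _ => B.piecewise σ τ) (fun τ _ => B.piecewise ρ τ) ?_ ?_ ?_ ?_
    · intro τ _
      simp +contextual
    · intro τ _
      refine Finset.mem_filter.2 ⟨Finset.mem_univ _, ?_⟩
      funext v
      by_cases hv : v ∈ B
      · simp [hv]
      · simp [hv, hρ v hv]
    · intro τ hτ
      have hτ := congrFun (Finset.mem_filter.1 hτ).2
      funext v
      by_cases hv : v ∈ B
      · simpa [hv] using (hτ v).symm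
      · simp [hv]
    · intro τ hτ
      have hτ := (Finset.mem_filter.1 hτ).2
      funext v
      by_cases hv : v ∈ B
      · simpa [hv] using (hτ v hv).symm
      · simp [hv]
  · rw [if_neg hρ, mul_zero]
    refine Finset.sum_eq_zero fun τ _ => if_neg ?_
    rintro rfl
    exact hρ fun v hv => (Finset.piecewise_eq_of_notMem _ _ _ hv).symm

/-- The conditional expectation of `f` given the configuration off `B`. -/
def condExpOff (β : ℝ) (B : Finset V) (f : Config V → ℝ) (σ : Config V) : ℝ :=
  (∑ τ, if AgreeOff B σ τ then gibbs G β τ * f τ else 0) /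
    ∑ τ, if AgreeOff B σ τ then gibbs G β τ else 0

lemma sum_agreeOff_gibbs_pos (β : ℝ) (B : Finset V) (σ : Config V) :
    0 < ∑ τ, if AgreeOff B σ τ then gibbs G β τ else 0 := by
  refine Finset.sum_pos' (fun τ _ => ?_) ⟨σ, Finset.mem_univ _, ?_⟩
  · split_ifs
    exacts [(gibbs_pos G β τ).le, le_rfl]
  · rw [if_pos (AgreeOff.refl B σ)]
    exact gibbs_pos G β σ

lemma condExpOff_plusInd (β : ℝ) {B : Finset V} {v : V} (hv : v ∈ B) (σ : Config V) :
    condExpOff G β B (plusInd v) σ =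
      Real.sigmoid (logRatio G β B (boundaryField G β B σ) v) := by
  obtain ⟨N, hN, hsum⟩ := exists_sum_piecewise B σ
  obtain ⟨K, hK, hw⟩ := exists_isingWeight_piecewise G β B σ
  set h := boundaryField G β B σ
  have hZ := sum_isingWeight_pos G β
  set Z := ∑ τ : Config V, isingWeight G β τ with hZdef
  have hp := fieldSumAt_pos G β B h v true
  have hm := fieldSumAt_pos G β B h v false
  have e1 : N * ∑ τ, (if AgreeOff B σ τ then gibbs G β τ * plusInd v τ else 0) =
      fieldSumAt G β B h v true * (K / Z) := by
    rw [← hsum fun τ => gibbs G β τ * plusInd v τ, fieldSumAt, Finset.sum_mul]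
    refine Finset.sum_congr rfl fun τ _ => ?_
    rw [gibbs, hw, ← hZdef, plusInd, Finset.piecewise_eq_of_mem _ _ _ hv]
    split_ifs <;> ring
  have e2 : N * ∑ τ, (if AgreeOff B σ τ then gibbs G β τ else 0) =
      (fieldSumAt G β B h v true + fieldSumAt G β B h v false) * (K / Z) := by
    rw [← hsum fun τ => gibbs G β τ, fieldSumAt, fieldSumAt, ← Finset.sum_add_distrib,
      Finset.sum_mul]
    refine Finset.sum_congr rfl fun τ _ => ?_
    rw [gibbs, hw, ← hZdef]
    cases τ v <;> simp <;> ring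
  rw [condExpOff, ← mul_div_mul_left _ _ hN.ne', e1, e2, Real.sigmoid_def, logRatio, neg_sub,
    Real.exp_sub, Real.exp_log hp, Real.exp_log hm]
  have hKZ : 0 < K / Z := div_pos hK hZ
  rw [mul_div_mul_right _ _ hKZ.ne']
  field_simp

lemma abs_sigmoid_sub_le (x y : ℝ) : |Real.sigmoid x - Real.sigmoid y| ≤ |x - y| := by
  have hbound : ∀ z : ℝ, ‖Real.sigmoid z * (1 - Real.sigmoid z)‖ ≤ 1 := by
    intro z
    have h1 := Real.sigmoid_nonneg z
    have h2 := Real.sigmoid_le_one z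
    rw [Real.norm_of_nonneg (mul_nonneg h1 (by linarith))]
    exact mul_le_one₀ h2 (by linarith) (by linarith)
  have := convex_univ.norm_image_sub_le_of_norm_hasDerivWithin_le
    (fun z _ => (Real.hasDerivAt_sigmoid z).hasDerivWithinAt) (fun z _ => hbound z)
    (Set.mem_univ y) (Set.mem_univ x)
  simpa [Real.norm_eq_abs] using this

lemma condExpOff_mulVec (β : ℝ) (hβ : 0 < β) (B : Finset V) (f : Config V → ℝ) :
    condExpOff G β B ((mswCensored G β B).mulVec f) = condExpOff G β B f := by
  funext σ
  rw [condExpOff, condExpOff]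
  congr 1
  have hacts := mswCensored_actsOn G hβ (B : Set V)
  have hrev := mswCensored_isReversible G β (B : Set V)
  have hstoch := mswCensored_mem_rowStochastic G hβ (B : Set V)
  have h1 : ∀ τ, (if AgreeOff B σ τ then gibbs G β τ * (mswCensored G β B).mulVec f τ else 0) =
      ∑ ρ, if AgreeOff B σ ρ then gibbs G β ρ * f ρ * mswCensored G β B ρ τ else 0 := by
    intro τ
    have h2 : ∀ ρ, mswCensored G β B τ ρ ≠ 0 → (AgreeOff B σ τ ↔ AgreeOff B σ ρ) := by
      intro ρ hρ
      have h3 : AgreeOff B τ ρ := fun v hv => (hacts τ ρ).1 hρ v (by simpa using hv)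
      exact ⟨fun h => h.trans h3, fun h => h.trans h3.symm⟩
    have h4 : (if AgreeOff B σ τ then gibbs G β τ * (mswCensored G β B).mulVec f τ else 0) =
        ∑ ρ, if AgreeOff B σ τ then gibbs G β τ * mswCensored G β B τ ρ * f ρ else 0 := by
      split_ifs
      · rw [Matrix.mulVec, dotProduct, Finset.mul_sum]
        exact Finset.sum_congr rfl fun ρ _ => by ring
      · simp
    rw [h4]
    refine Finset.sum_congr rfl fun ρ _ => ?_
    have h5 := hrev τ ρ
    by_cases hρ : mswCensored G β B τ ρ = 0
    · have h6 : mswCensored G β B ρ τ = 0 := by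
        rw [hρ, mul_zero] at h5
        exact (mul_eq_zero.1 h5.symm).resolve_left (gibbs_pos G β ρ).ne'
      simp [hρ, h6]
    · refine if_congr (h2 ρ hρ) ?_ rfl
      linear_combination f ρ * h5
  rw [Finset.sum_congr rfl fun τ _ => h1 τ, Finset.sum_comm]
  refine Finset.sum_congr rfl fun ρ _ => ?_
  split_ifs
  · rw [← Finset.mul_sum, Matrix.sum_row_of_mem_rowStochastic hstoch, mul_one]
  · simp

/-- The oscillation of `f` over configurations that agree off `B` is at most `D`. -/
def OscOffLE (B : Finset V) (f : Config V → ℝ) (D : ℝ) : Prop :=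
  ∀ σ τ : Config V, AgreeOff B σ τ → f σ - f τ ≤ D

lemma abs_sub_condExpOff_le (β : ℝ) {B : Finset V} {f : Config V → ℝ} {D : ℝ}
    (hf : OscOffLE B f D) (σ : Config V) : |f σ - condExpOff G β B f σ| ≤ D := by
  have hpos := sum_agreeOff_gibbs_pos G β B σ
  have e : f σ - condExpOff G β B f σ =
      (∑ τ, if AgreeOff B σ τ then gibbs G β τ * (f σ - f τ) else 0) /
        ∑ τ, if AgreeOff B σ τ then gibbs G β τ else 0 := by
    rw [condExpOff, eq_div_iff hpos.ne', sub_mul, div_mul_cancel₀ _ hpos.ne', Finset.mul_sum,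
      ← Finset.sum_sub_distrib]
    refine Finset.sum_congr rfl fun τ _ => ?_
    split_ifs <;> ring
  rw [e, abs_div, abs_of_pos hpos, div_le_iff₀ hpos, Finset.mul_sum]
  refine (Finset.abs_sum_le_sum_abs _ _).trans (Finset.sum_le_sum fun τ _ => ?_)
  by_cases h : AgreeOff B σ τ
  · rw [if_pos h, if_pos h, abs_mul, abs_of_pos (gibbs_pos G β τ), mul_comm]
    refine mul_le_mul_of_nonneg_right (abs_le.2 ⟨?_, hf σ τ h⟩) (gibbs_pos G β τ).le
    have := hf τ σ h.symm
    linarith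
  · simp [h]

variable {G}

lemma stepMap_agreeOff (B : Finset V) (ω : Finset (Sym2 V)) (s σ : Config V) :
    AgreeOff B (stepMap G B ω s σ) σ := by
  intro v hv
  have h : ∀ b, ¬ ∀ w, (percGraph (ω ∩ agreeEdges G σ)).Reachable v w → w ∈ (B : Set V) ∧ s w = b :=
    fun b h => hv (by simpa using (h v (.refl _)).1)
  simp only [stepMap, step, if_neg (h _)]

variable (G)

/-- The edges incident to `B`. -/
def incidentEdges (B : Finset V) : Finset (Sym2 V) :=
  G.edgeFinset.filter fun e => ∃ v ∈ B, v ∈ e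

variable {G} in
lemma card_incidentEdges_le {d : ℕ} (hd : ∀ v, G.degree v ≤ d) (B : Finset V) :
    (incidentEdges G B).card ≤ B.card * d := by
  have hsub : incidentEdges G B ⊆ B.biUnion fun v => G.incidenceFinset v := by
    intro e he
    obtain ⟨he, v, hv, hve⟩ := Finset.mem_filter.1 he
    refine Finset.mem_biUnion.2 ⟨v, hv, ?_⟩
    rw [SimpleGraph.mem_incidenceFinset]
    exact ⟨by simpa using he, hve⟩
  refine (Finset.card_le_card hsub).trans (Finset.card_biUnion_le_card_mul _ _ _ fun v _ => ?_)
  rw [G.card_incidenceFinset_eq_degree]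
  exact hd v

lemma sum_coinWeight_sdiff (β : ℝ) (B : Finset V) :
    ∑ ω ∈ (G.edgeFinset \ incidentEdges G B).powerset, coinWeight G β ω =
      Real.exp (-2 * β) ^ (incidentEdges G B).card := by
  set I := incidentEdges G B
  have hI : I ⊆ G.edgeFinset := Finset.filter_subset _ _
  have h := Finset.sum_pow_mul_eq_add_pow (1 - Real.exp (-2 * β)) (Real.exp (-2 * β))
    (G.edgeFinset \ I)
  rw [sub_add_cancel, one_pow] at h
  rw [← mul_one (Real.exp (-2 * β) ^ I.card), ← h, Finset.mul_sum]
  refine Finset.sum_congr rfl fun ω hω => ?_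
  have hω := Finset.mem_powerset.1 hω
  have hc : (G.edgeFinset \ ω).card = I.card + ((G.edgeFinset \ I).card - ω.card) := by
    rw [Finset.card_sdiff_of_subset (hω.trans Finset.sdiff_subset)]
    have h1 := Finset.card_le_card hω
    have h2 := Finset.card_sdiff_add_card_eq_card hI
    omega
  rw [coinWeight, hc, pow_add]
  ring

lemma OscOffLE.mulVec {β : ℝ} (hβ : 0 < β) {B : Finset V} {f : Config V → ℝ} {D : ℝ}
    (hD : 0 ≤ D) (hf : OscOffLE B f D) {n : ℕ} (hn : (incidentEdges G B).card ≤ n) :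
    OscOffLE B ((mswCensored G β B).mulVec f) ((1 - Real.exp (-2 * β) ^ n) * D) := by
  intro σ τ hστ
  set I := incidentEdges G B with hI
  have hq := exp_neg_two_mul_lt_one hβ
  have hpow : Real.exp (-2 * β) ^ n ≤ Real.exp (-2 * β) ^ I.card :=
    pow_le_pow_of_le_one (Real.exp_pos _).le hq.le hn
  have hsub : (G.edgeFinset \ I).powerset ⊆ G.edgeFinset.powerset :=
    Finset.powerset_mono.2 Finset.sdiff_subset
  have hbad : ∑ ω ∈ G.edgeFinset.powerset \ (G.edgeFinset \ I).powerset, coinWeight G β ω =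
      1 - Real.exp (-2 * β) ^ I.card := by
    rw [← sum_coinWeight_sdiff, eq_sub_iff_add_eq, Finset.sum_sdiff hsub, sum_coinWeight]
  have hgood : ∀ ω ∈ (G.edgeFinset \ I).powerset, ∀ s : Config V,
      stepMap G B ω s σ = stepMap G B ω s τ := by
    intro ω hω s
    have hω' : ∀ e ∈ ω, ∀ v ∈ e, v ∉ (B : Set V) := by
      intro e he v hve hv
      have := Finset.mem_sdiff.1 (Finset.mem_powerset.1 hω he)
      exact this.2 (Finset.mem_filter.2 ⟨this.1, v, hv, hve⟩)
    rw [stepMap_of_forall_notMem hω', stepMap_of_forall_notMem hω']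
    funext v
    by_cases hv : v ∈ (B : Set V)
    · simp [hv]
    · simp only [if_neg hv]
      exact hστ v (by simpa using hv)
  rw [mswCensored_mulVec, mswCensored_mulVec, ← Finset.sum_sub_distrib,
    ← Finset.sum_sdiff hsub]
  have h0 : ∑ ω ∈ (G.edgeFinset \ I).powerset,
      (∑ s : Config V, coinWeight G β ω * (1 / 2) ^ Fintype.card V * f (stepMap G B ω s σ) -
        ∑ s : Config V, coinWeight G β ω * (1 / 2) ^ Fintype.card V * f (stepMap G B ω s τ)) =
      0 := by
    refine Finset.sum_eq_zero fun ω hω => sub_eq_zero.2 (Finset.sum_congr rfl fun s _ => ?_)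
    rw [hgood ω hω s]
  rw [h0, add_zero]
  calc _ ≤ ∑ ω ∈ G.edgeFinset.powerset \ (G.edgeFinset \ I).powerset, coinWeight G β ω * D := by
        refine Finset.sum_le_sum fun ω _ => ?_
        have hw := coinWeight_nonneg G hβ ω
        rw [← Finset.sum_sub_distrib]
        have : ∀ s : Config V, coinWeight G β ω * (1 / 2) ^ Fintype.card V *
            f (stepMap G B ω s σ) - coinWeight G β ω * (1 / 2) ^ Fintype.card V *
            f (stepMap G B ω s τ) ≤ coinWeight G β ω * (1 / 2) ^ Fintype.card V * D := by
          intro s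
          rw [← mul_sub]
          refine mul_le_mul_of_nonneg_left (hf _ _ ?_) (by positivity)
          exact ((stepMap_agreeOff B ω s σ).trans hστ).trans (stepMap_agreeOff B ω s τ).symm
        refine (Finset.sum_le_sum fun s _ => this s).trans_eq ?_
        rw [Finset.sum_const, Finset.card_univ, Fintype.card_fun, Fintype.card_bool, nsmul_eq_mul,
          Nat.cast_pow, Nat.cast_ofNat]
        have h2 : (2 : ℝ) ^ Fintype.card V * (1 / 2) ^ Fintype.card V = 1 := by
          rw [← mul_pow]
          norm_num
        linear_combination (coinWeight G β ω * D) * h2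
    _ = (1 - Real.exp (-2 * β) ^ I.card) * D := by rw [← Finset.sum_mul, hbad]
    _ ≤ (1 - Real.exp (-2 * β) ^ n) * D := mul_le_mul_of_nonneg_right (by linarith) hD

lemma pow_succ_mulVec {S : Type*} [Fintype S] [DecidableEq S] (P : Matrix S S ℝ) (k : ℕ)
    (f : S → ℝ) : (P ^ (k + 1)).mulVec f = P.mulVec ((P ^ k).mulVec f) := by
  rw [pow_succ', Matrix.mulVec_mulVec]

lemma abs_pow_mulVec_sub_condExpOff_le {β : ℝ} (hβ : 0 < β) {B : Finset V} {f : Config V → ℝ}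
    (hf : OscOffLE B f 1) {n : ℕ} (hn : (incidentEdges G B).card ≤ n) (k : ℕ) (σ : Config V) :
    |(mswCensored G β B ^ k).mulVec f σ - condExpOff G β B f σ| ≤
      (1 - Real.exp (-2 * β) ^ n) ^ k := by
  have hq : 0 ≤ 1 - Real.exp (-2 * β) ^ n :=
    sub_nonneg.2 (pow_le_one₀ (Real.exp_pos _).le (exp_neg_two_mul_lt_one hβ).le)
  have h : OscOffLE B ((mswCensored G β B ^ k).mulVec f) ((1 - Real.exp (-2 * β) ^ n) ^ k) ∧
      condExpOff G β B ((mswCensored G β B ^ k).mulVec f) = condExpOff G β B f := by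
    induction k with
    | zero => simpa using hf
    | succ k ih =>
      rw [pow_succ_mulVec, condExpOff_mulVec G β hβ, pow_succ']
      exact ⟨ih.1.mulVec G hβ (pow_nonneg hq k) hn, ih.2⟩
  rw [← h.2]
  exact abs_sub_condExpOff_le G β h.1 σ

variable {G}

/-- The components inside `B` are determined by the spins on `B` and its neighbours. -/
lemma stepMap_eq_of_eqOn {B W : Finset V} (hBW : B ⊆ W)
    (hW : ∀ x ∈ B, ∀ y, G.Adj x y → y ∈ W) (ω : Finset (Sym2 V)) (s : Config V) {σ τ : Config V}
    (h : ∀ v ∈ W, σ v = τ v) : ∀ v ∈ W, stepMap G B ω s σ v = stepMap G B ω s τ v := by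
  intro v hv
  have key : ∀ {σ τ : Config V}, (∀ v ∈ W, σ v = τ v) → ∀ b,
      (∀ w, (percGraph (ω ∩ agreeEdges G σ)).Reachable v w → w ∈ (B : Set V) ∧ s w = b) →
      ∀ w, (percGraph (ω ∩ agreeEdges G τ)).Reachable v w → w ∈ (B : Set V) ∧ s w = b := by
    intro σ τ h b hσ w hw
    refine hσ w ?_
    rw [SimpleGraph.reachable_iff_reflTransGen] at hw
    induction hw with
    | refl => exact .refl _
    | tail _ hadj ih =>
      refine ih.trans (SimpleGraph.Adj.reachable ?_)
      have hB := (hσ _ ih).1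
      rw [percGraph_adj_iff] at hadj ⊢
      refine ⟨hadj.1, hadj.2.1, ?_⟩
      rw [h _ (hBW hB), h _ (hW _ hB _ hadj.2.1)]
      exact hadj.2.2
  have hiff : ∀ b, (∀ w, (percGraph (ω ∩ agreeEdges G σ)).Reachable v w →
        w ∈ (B : Set V) ∧ s w = b) ↔
      ∀ w, (percGraph (ω ∩ agreeEdges G τ)).Reachable v w → w ∈ (B : Set V) ∧ s w = b :=
    fun b => ⟨key h b, key (fun v hv => (h v hv).symm) b⟩
  simp only [stepMap, step, hiff, h v hv]
  congr!

lemma pow_mulVec_eq_of_eqOn (β : ℝ) {B W : Finset V} (hBW : B ⊆ W)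
    (hW : ∀ x ∈ B, ∀ y, G.Adj x y → y ∈ W) {f : Config V → ℝ}
    (hf : ∀ σ τ : Config V, (∀ v ∈ W, σ v = τ v) → f σ = f τ) (k : ℕ) :
    ∀ σ τ : Config V, (∀ v ∈ W, σ v = τ v) →
      (mswCensored G β B ^ k).mulVec f σ = (mswCensored G β B ^ k).mulVec f τ := by
  induction k with
  | zero => simpa using hf
  | succ k ih =>
    intro σ τ h
    rw [pow_succ_mulVec, mswCensored_mulVec, mswCensored_mulVec]
    refine Finset.sum_congr rfl fun ω _ => Finset.sum_congr rfl fun s _ => ?_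
    rw [ih _ _ (stepMap_eq_of_eqOn hBW hW ω s h)]

end Local

/-! ### Censoring and contraction -/

section Contraction

variable {V : Type*} [Fintype V] [DecidableEq V] (G : SimpleGraph V) [DecidableRel G.Adj]

lemma IsReversible.innerMu_mulVec {S : Type*} [Fintype S] {μ : S → ℝ} {P : Matrix S S ℝ}
    (h : IsReversible μ P) (f g : S → ℝ) :
    innerMu μ (P.mulVec f) g = innerMu μ f (P.mulVec g) := by
  simp only [innerMu, Matrix.mulVec, dotProduct, Finset.mul_sum, Finset.sum_mul]
  rw [Finset.sum_comm]
  refine Finset.sum_congr rfl fun y _ => Finset.sum_congr rfl fun x _ => ?_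
  linear_combination (f y * g x) * h x y

lemma IsReversible.innerMu_pow_mulVec {S : Type*} [Fintype S] [DecidableEq S] {μ : S → ℝ}
    {P : Matrix S S ℝ} (h : IsReversible μ P) (k : ℕ) (f g : S → ℝ) :
    innerMu μ ((P ^ k).mulVec f) g = innerMu μ f ((P ^ k).mulVec g) := by
  induction k generalizing f g with
  | zero => simp
  | succ k ih =>
    rw [pow_succ_mulVec, h.innerMu_mulVec, ih, Matrix.mulVec_mulVec, ← pow_succ]

lemma monotone_mswCensored_mulVec {β : ℝ} (hβ : 0 < β) (A : Set V) {f : Config V → ℝ}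
    (hf : Monotone f) : Monotone ((mswCensored G β A).mulVec f) := by
  intro σ τ h
  rw [mswCensored_mulVec, mswCensored_mulVec]
  refine Finset.sum_le_sum fun ω _ => Finset.sum_le_sum fun s _ =>
    mul_le_mul_of_nonneg_left (hf (stepMap_monotone A ω s h)) ?_
  have := coinWeight_nonneg G hβ ω
  positivity

lemma monotone_pow_mulVec {β : ℝ} (hβ : 0 < β) (A : Set V) {f : Config V → ℝ}
    (hf : Monotone f) (k : ℕ) : Monotone ((mswCensored G β A ^ k).mulVec f) := by
  induction k with
  | zero => simpa using hf
  | succ k ih =>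
    rw [pow_succ_mulVec]
    exact monotone_mswCensored_mulVec G hβ A ih

lemma innerMu_msw_pow_le {β : ℝ} (hβ : 0 < β) (A : Set V) {f g : Config V → ℝ} (hf : Monotone f)
    (hg : Monotone g) (k : ℕ) :
    innerMu (gibbs G β) ((msw G β ^ k).mulVec f) g ≤
      innerMu (gibbs G β) ((mswCensored G β A ^ k).mulVec f) g := by
  have hrev : IsReversible (gibbs G β) (msw G β) := mswCensored_isReversible G β Set.univ
  induction k generalizing g with
  | zero => simp
  | succ k ih =>
    rw [pow_succ_mulVec, pow_succ_mulVec, hrev.innerMu_mulVec]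
    refine (ih (monotone_mswCensored_mulVec G hβ Set.univ hg)).trans ?_
    refine (hrev.innerMu_mulVec _ _).symm.trans_le ?_
    exact innerMu_msw_le G hβ A (monotone_pow_mulVec G hβ A hf k) hg

/-- Censoring the last `k` of `t + k` steps. -/
lemma innerMu_msw_pow_add_le {β : ℝ} (hβ : 0 < β) (A : Set V) {f g : Config V → ℝ}
    (hf : Monotone f) (hg : Monotone g) (t k : ℕ) :
    innerMu (gibbs G β) ((msw G β ^ (t + k)).mulVec f) g ≤
      innerMu (gibbs G β) ((msw G β ^ t).mulVec ((mswCensored G β A ^ k).mulVec f)) g := by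
  have hrev : IsReversible (gibbs G β) (msw G β) := mswCensored_isReversible G β Set.univ
  rw [pow_add, ← Matrix.mulVec_mulVec, hrev.innerMu_pow_mulVec t, hrev.innerMu_pow_mulVec t]
  exact innerMu_msw_pow_le G hβ A hf (monotone_pow_mulVec G hβ Set.univ hg t) k

lemma innerMu_ite_eq {S : Type*} [Fintype S] [DecidableEq S] (μ f : S → ℝ) (x : S) (a : ℝ) :
    innerMu μ f (fun y => if y = x then a else 0) = μ x * f x * a := by
  simp [innerMu]

lemma msw_pow_mulVec_top_le {β : ℝ} (hβ : 0 < β) (A : Set V) {f : Config V → ℝ}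
    (hf : Monotone f) (t k : ℕ) :
    (msw G β ^ (t + k)).mulVec f ⊤ ≤
      (msw G β ^ t).mulVec ((mswCensored G β A ^ k).mulVec f) ⊤ := by
  have hg : Monotone fun σ : Config V => if σ = ⊤ then (1 : ℝ) else 0 := by
    intro σ τ h
    dsimp only
    by_cases hσ : σ = ⊤
    · rw [if_pos hσ, if_pos (top_le_iff.1 (hσ ▸ h))]
    · rw [if_neg hσ]
      split_ifs <;> norm_num
  have := innerMu_msw_pow_add_le G hβ A hf hg t k
  rw [innerMu_ite_eq, innerMu_ite_eq, mul_one, mul_one] at this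
  exact le_of_mul_le_mul_left this (gibbs_pos G β ⊤)

lemma le_msw_pow_mulVec_bot {β : ℝ} (hβ : 0 < β) (A : Set V) {f : Config V → ℝ}
    (hf : Monotone f) (t k : ℕ) :
    (msw G β ^ t).mulVec ((mswCensored G β A ^ k).mulVec f) ⊥ ≤
      (msw G β ^ (t + k)).mulVec f ⊥ := by
  have hg : Monotone fun σ : Config V => if σ = ⊥ then (-1 : ℝ) else 0 := by
    intro σ τ h
    dsimp only
    by_cases hτ : τ = ⊥
    · rw [if_pos hτ, if_pos (le_bot_iff.1 (hτ ▸ h))]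
    · rw [if_neg hτ]
      split_ifs <;> norm_num
  have := innerMu_msw_pow_add_le G hβ A hf hg t k
  rw [innerMu_ite_eq, innerMu_ite_eq, mul_neg_one, mul_neg_one, neg_le_neg_iff] at this
  exact le_of_mul_le_mul_left this (gibbs_pos G β ⊥)

omit [Fintype V] [DecidableEq V] in
lemma monotone_plusInd (v : V) : Monotone (plusInd v) := by
  intro σ τ h
  have := Bool.le_iff_imp.1 (h v)
  unfold plusInd
  split_ifs <;> simp_all

omit [Fintype V] [DecidableEq V] in
lemma plusInd_sub_le_one (v : V) (σ τ : Config V) : plusInd v σ - plusInd v τ ≤ 1 := by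
  unfold plusInd
  split_ifs <;> norm_num

omit [Fintype V] [DecidableEq V] in
lemma plusInd_sub_eq_one {v : V} {σ τ : Config V} (h : τ v ≤ σ v) (hne : σ v ≠ τ v) :
    plusInd v σ - plusInd v τ = 1 := by
  rw [Bool.le_iff_imp] at h
  unfold plusInd
  cases hσ : σ v <;> cases hτ : τ v <;> simp [hσ, hτ] at h hne ⊢

omit [Fintype V] [DecidableEq V] in
lemma spin_sub_spin (v : V) (σ τ : Config V) :
    spin (σ v) - spin (τ v) = 2 * (plusInd v σ - plusInd v τ) := by
  unfold plusInd spin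
  split_ifs <;> norm_num

/-- The difference of the probabilities of a spin `+` at `v` after `t` steps from the two
extremal configurations. -/
def extremalGap (β : ℝ) (t : ℕ) (v : V) : ℝ :=
  (msw G β ^ t).mulVec (plusInd v) ⊤ - (msw G β ^ t).mulVec (plusInd v) ⊥

lemma extremalGap_add_le {β : ℝ} (hβ : 0 < β) (A : Set V) (v : V) (k : ℕ) (c : V → ℝ)
    (hc : Monotone fun σ => ∑ u, c u * plusInd u σ -
      (mswCensored G β A ^ k).mulVec (plusInd v) σ) (t : ℕ) :
    extremalGap G β (t + k) v ≤ ∑ u, c u * extremalGap G β t u := by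
  have h1 := msw_pow_mulVec_top_le G hβ A (monotone_plusInd v) t k
  have h2 := le_msw_pow_mulVec_bot G hβ A (monotone_plusInd v) t k
  have h3 := monotone_pow_mulVec G hβ Set.univ hc t (bot_le (a := (⊤ : Config V)))
  have h4 : ∀ σ, (mswCensored G β Set.univ ^ t).mulVec (fun σ => ∑ u, c u * plusInd u σ -
      (mswCensored G β A ^ k).mulVec (plusInd v) σ) σ =
      ∑ u, c u * (msw G β ^ t).mulVec (plusInd u) σ -
        (msw G β ^ t).mulVec ((mswCensored G β A ^ k).mulVec (plusInd v)) σ := by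
    intro σ
    simp only [msw, Matrix.mulVec, dotProduct, mul_sub, Finset.sum_sub_distrib, Finset.mul_sum]
    congr 1
    rw [Finset.sum_comm]
    exact Finset.sum_congr rfl fun u _ => Finset.sum_congr rfl fun τ _ => by ring
  rw [h4, h4] at h3
  simp only [extremalGap, mul_sub, Finset.sum_sub_distrib]
  linarith

variable {G}

lemma boundaryField_sub_le {β : ℝ} (hβ : 0 < β) (v : V) (R : ℕ) {σ τ : Config V} (h : τ ≤ σ)
    (x : V) :
    |boundaryField G β (ball G v (R + 1)) σ x - boundaryField G β (ball G v (R + 1)) τ x| ≤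
      if x ∈ (ball G v R)ᶜ then
        ∑ y, (if G.Adj x y then 2 * β * (plusInd y σ - plusInd y τ) else 0) else 0 := by
  have hδ : ∀ y, 0 ≤ plusInd y σ - plusInd y τ := fun y => sub_nonneg.2 (monotone_plusInd y h)
  have hterm : ∀ y, 0 ≤ (if G.Adj x y then 2 * β * (plusInd y σ - plusInd y τ) else 0) := by
    intro y
    have := hδ y
    split_ifs <;> positivity
  by_cases hxR : x ∈ ball G v R
  · have hz : ∀ ρ : Config V, boundaryField G β (ball G v (R + 1)) ρ x = 0 := by
      intro ρ
      rw [boundaryField, if_pos (ball_subset_succ G v R hxR)]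
      rw [Finset.sum_eq_zero, mul_zero]
      intro y hy
      exact if_neg fun hadj => Finset.mem_compl.1 hy (mem_ball_succ_of_adj hxR hadj)
    rw [hz, hz, if_neg (by simpa using hxR), sub_zero, abs_zero]
  · rw [if_pos (Finset.mem_compl.2 hxR)]
    by_cases hx : x ∈ ball G v (R + 1)
    · simp only [boundaryField, if_pos hx]
      rw [← mul_sub, ← Finset.sum_sub_distrib]
      have e : β * ∑ y ∈ (ball G v (R + 1))ᶜ, ((if G.Adj x y then spin (σ y) else 0) -
          (if G.Adj x y then spin (τ y) else 0)) = ∑ y ∈ (ball G v (R + 1))ᶜ,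
          (if G.Adj x y then 2 * β * (plusInd y σ - plusInd y τ) else 0) := by
        rw [Finset.mul_sum]
        refine Finset.sum_congr rfl fun y _ => ?_
        split_ifs
        · rw [spin_sub_spin]
          ring
        · ring
      rw [e, abs_of_nonneg (Finset.sum_nonneg fun y _ => hterm y)]
      exact Finset.sum_le_sum_of_subset_of_nonneg (Finset.subset_univ _) fun y _ _ => hterm y
    · simp only [boundaryField, if_neg hx, sub_zero, abs_zero]
      exact Finset.sum_nonneg fun y _ => hterm y

/-- The influence of the boundary on the conditional law of the spin at the centre of a ball. -/
lemma exists_condExpOff_sub_le {β : ℝ} (hβ : 0 < β) {d : ℕ} (hd1 : 1 ≤ d)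
    (hd : ∀ v, G.degree v ≤ d + 1) (hκ : d * Real.tanh β < 1) (v : V) (R : ℕ) :
    ∃ e : V → ℝ, (∀ u, 0 ≤ e u) ∧
      ∑ u, e u ≤ 2 * β * (d + 1) * (4 / (1 - d * Real.tanh β) * (d * Real.tanh β) ^ (R + 1)) ∧
      ∀ σ τ : Config V, τ ≤ σ →
        condExpOff G β (ball G v (R + 1)) (plusInd v) σ -
          condExpOff G β (ball G v (R + 1)) (plusInd v) τ ≤
        ∑ u, e u * (plusInd u σ - plusInd u τ) := by
  obtain ⟨c, hc0, hc, hsum⟩ := exists_isInfluenceBound hβ.le hd1 hd hκ v R (ball G v (R + 1))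
    (mem_ball_self G v _)
  refine ⟨fun u => ∑ x ∈ (ball G v R)ᶜ, (if G.Adj x u then 2 * β * c x else 0), fun u => ?_, ?_,
    fun σ τ h => ?_⟩
  · refine Finset.sum_nonneg fun x _ => ?_
    have := hc0 x
    split_ifs <;> positivity
  · rw [Finset.sum_comm]
    have h1 : ∀ x, ∑ u, (if G.Adj x u then 2 * β * c x else 0) ≤ 2 * β * (d + 1) * c x := by
      intro x
      rw [← Finset.sum_filter, Finset.sum_const, nsmul_eq_mul, ← G.neighborFinset_eq_filter,
        G.card_neighborFinset_eq_degree]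
      have h2 : (G.degree x : ℝ) ≤ d + 1 := by exact_mod_cast hd x
      have h3 := mul_le_mul_of_nonneg_right h2 (mul_nonneg (mul_nonneg zero_le_two hβ.le) (hc0 x))
      linarith
    refine (Finset.sum_le_sum fun x _ => h1 x).trans ?_
    rw [← Finset.mul_sum]
    exact mul_le_mul_of_nonneg_left hsum (by positivity)
  · rw [condExpOff_plusInd G β (mem_ball_self G v _), condExpOff_plusInd G β (mem_ball_self G v _)]
    refine (le_abs_self _).trans ((abs_sigmoid_sub_le _ _).trans ((hc _ _).trans ?_))
    refine (Finset.sum_le_sum fun x _ =>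
      mul_le_mul_of_nonneg_left (boundaryField_sub_le hβ v R h x) (hc0 x)).trans_eq ?_
    simp only [mul_ite, mul_zero]
    rw [Finset.sum_ite_mem, Finset.univ_inter]
    simp only [Finset.sum_mul]
    rw [Finset.sum_comm]
    refine Finset.sum_congr rfl fun x _ => ?_
    rw [Finset.mul_sum]
    refine Finset.sum_congr rfl fun y _ => ?_
    split_ifs <;> ring

lemma exists_monotone_sub {β : ℝ} (hβ : 0 < β) {d : ℕ} (hd1 : 1 ≤ d)
    (hd : ∀ v, G.degree v ≤ d + 1) (hκ : d * Real.tanh β < 1) (v : V) (R m : ℕ) :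
    ∃ c : V → ℝ, (∀ u, 0 ≤ c u) ∧
      ∑ u, c u ≤ 2 * β * (d + 1) * (4 / (1 - d * Real.tanh β) * (d * Real.tanh β) ^ (R + 1)) +
        2 * (1 - Real.exp (-2 * β) ^ ((d + 2) ^ (R + 1) * (d + 1))) ^ m * (d + 2) ^ (R + 2) ∧
      Monotone fun σ => ∑ u, c u * plusInd u σ -
        (mswCensored G β (ball G v (R + 1)) ^ m).mulVec (plusInd v) σ := by
  obtain ⟨e, he0, hesum, he⟩ := exists_condExpOff_sub_le hβ hd1 hd hκ v R
  set B := ball G v (R + 1) with hB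
  set W := ball G v (R + 2) with hW
  set n := (d + 2) ^ (R + 1) * (d + 1) with hn
  set η := (1 - Real.exp (-2 * β) ^ n) ^ m with hη
  have hη0 : 0 ≤ η := pow_nonneg
    (sub_nonneg.2 (pow_le_one₀ (Real.exp_pos _).le (exp_neg_two_mul_lt_one hβ).le)) m
  have hIn : (incidentEdges G B).card ≤ n :=
    (card_incidentEdges_le hd B).trans (Nat.mul_le_mul_right _ (card_ball_le hd v _))
  have hWcard : (W.card : ℝ) ≤ (d + 2) ^ (R + 2) := by exact_mod_cast card_ball_le hd v (R + 2)
  refine ⟨fun u => e u + (if u ∈ W then 2 * η else 0), fun u => ?_, ?_, fun τ σ h => ?_⟩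
  · refine add_nonneg (he0 u) ?_
    split_ifs <;> positivity
  · rw [Finset.sum_add_distrib, Finset.sum_ite_mem, Finset.univ_inter, Finset.sum_const,
      nsmul_eq_mul]
    refine add_le_add hesum ?_
    rw [mul_comm]
    exact mul_le_mul_of_nonneg_left hWcard (by positivity)
  · have hδ : ∀ u, 0 ≤ plusInd u σ - plusInd u τ := fun u => sub_nonneg.2 (monotone_plusInd u h)
    have hmain : (mswCensored G β B ^ m).mulVec (plusInd v) σ -
        (mswCensored G β B ^ m).mulVec (plusInd v) τ ≤
        ∑ u, (e u + (if u ∈ W then 2 * η else 0)) * (plusInd u σ - plusInd u τ) := by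
      have hterm : ∀ u, 0 ≤ (e u + (if u ∈ W then 2 * η else 0)) *
          (plusInd u σ - plusInd u τ) := by
        intro u
        refine mul_nonneg (add_nonneg (he0 u) ?_) (hδ u)
        split_ifs <;> positivity
      by_cases hag : ∀ u ∈ W, σ u = τ u
      · rw [pow_mulVec_eq_of_eqOn β (ball_subset_succ G v (R + 1))
          (fun x hx y hxy => mem_ball_succ_of_adj hx hxy) (f := plusInd v) ?_ m σ τ hag, sub_self]
        · exact Finset.sum_nonneg fun u _ => hterm u
        · intro σ' τ' h'
          rw [plusInd, plusInd, h' v (mem_ball_self G v _)]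
      · push Not at hag
        obtain ⟨w, hw, hne⟩ := hag
        have hw1 : plusInd w σ - plusInd w τ = 1 :=
          plusInd_sub_eq_one (h w) hne
        have hosc : OscOffLE B (plusInd v) 1 := fun σ τ _ => plusInd_sub_le_one v σ τ
        have h1 := abs_le.1 (abs_pow_mulVec_sub_condExpOff_le G hβ hosc hIn m σ)
        have h2 := abs_le.1 (abs_pow_mulVec_sub_condExpOff_le G hβ hosc hIn m τ)
        have h3 := he σ τ h
        have h4 : 2 * η ≤ ∑ u, (if u ∈ W then 2 * η else 0) * (plusInd u σ - plusInd u τ) := by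
          refine le_trans ?_ (Finset.single_le_sum (fun u _ => mul_nonneg ?_ (hδ u))
            (Finset.mem_univ w))
          · rw [if_pos hw, hw1, mul_one]
          · split_ifs <;> positivity
        simp only [add_mul, Finset.sum_add_distrib]
        linarith [h1.1, h1.2, h2.1, h2.2]
    simp only [mul_sub, Finset.sum_sub_distrib] at hmain
    dsimp only
    linarith

end Contraction

/-- The extremal chains approach each other at a rate that depends only on the degree and the
temperature. -/
theorem exists_extremalGap_le {β : ℝ} (hβ : 0 < β) {d : ℕ} (hd1 : 1 ≤ d)
    (hκ : d * Real.tanh β < 1) :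
    ∃ m : ℕ, 1 ≤ m ∧ ∀ (V : Type u) [Fintype V] [DecidableEq V] (G : SimpleGraph V)
      [DecidableRel G.Adj], (∀ v, G.degree v ≤ d + 1) →
        ∀ (k : ℕ) (v : V), extremalGap G β (k * m) v ≤ (1 / 2) ^ k := by
  have hθ := tanh_nonneg_of_nonneg hβ.le
  have hlim : ∀ {r : ℝ}, 0 ≤ r → r < 1 → ∀ K : ℝ, ∃ N : ℕ, ∀ n ≥ N, K * r ^ n ≤ 1 / 4 := by
    intro r h0 h1 K
    have h := (tendsto_pow_atTop_nhds_zero_of_lt_one h0 h1).const_mul K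
    rw [mul_zero] at h
    exact Filter.eventually_atTop.1 (h.eventually_le_const (by norm_num))
  obtain ⟨R, hR⟩ := hlim (r := d * Real.tanh β) (by positivity) hκ
    (2 * β * (d + 1) * (4 / (1 - d * Real.tanh β)))
  have hq := exp_neg_two_mul_lt_one hβ
  have hq0 := Real.exp_pos (-2 * β)
  obtain ⟨m, hm⟩ := hlim (r := 1 - Real.exp (-2 * β) ^ ((d + 2) ^ (R + 1) * (d + 1)))
    (sub_nonneg.2 (pow_le_one₀ hq0.le hq.le)) (sub_lt_self 1 (pow_pos hq0 _))
    (2 * (d + 2) ^ (R + 2))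
  refine ⟨m + 1, Nat.le_add_left 1 m, fun V _ _ G _ hd k => ?_⟩
  induction k with
  | zero =>
    intro v
    simp only [extremalGap, zero_mul, pow_zero, Matrix.one_mulVec]
    exact plusInd_sub_le_one v _ _
  | succ k ih =>
    intro v
    obtain ⟨c, hc0, hcsum, hc⟩ := exists_monotone_sub hβ hd1 hd hκ v R (m + 1)
    have h1 := extremalGap_add_le G hβ _ v (m + 1) c hc (k * (m + 1))
    have h2 : ∑ u, c u ≤ 1 / 2 := by
      have e1 := hR (R + 1) (Nat.le_succ R)
      have e2 := hm (m + 1) (Nat.le_succ m)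
      refine hcsum.trans ?_
      linarith
    rw [add_one_mul]
    refine h1.trans ((Finset.sum_le_sum fun u _ =>
      mul_le_mul_of_nonneg_left (ih u) (hc0 u)).trans ?_)
    rw [← Finset.sum_mul, pow_succ, mul_comm]
    exact mul_le_mul_of_nonneg_left h2 (by positivity)

/-! ### Mixing and relaxation -/

section Mixing

variable {V : Type*} [Fintype V] [DecidableEq V] (G : SimpleGraph V) [DecidableRel G.Adj]

omit [DecidableEq V] in
lemma sub_le_mul_sum_plusInd {g : Config V → ℝ} {M : ℝ} (hM : 0 ≤ M)
    (hg : ∀ σ τ, g σ - g τ ≤ M) {σ τ : Config V} (h : τ ≤ σ) :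
    g σ - g τ ≤ M * ∑ v, (plusInd v σ - plusInd v τ) := by
  have hδ : ∀ u, 0 ≤ plusInd u σ - plusInd u τ := fun u => sub_nonneg.2 (monotone_plusInd u h)
  by_cases heq : σ = τ
  · simp [heq]
  · obtain ⟨v, hv⟩ := Function.ne_iff.1 heq
    have h1 : plusInd v σ - plusInd v τ = 1 := plusInd_sub_eq_one (h v) hv
    have h2 : 1 ≤ ∑ v, (plusInd v σ - plusInd v τ) := by
      rw [← h1]
      exact Finset.single_le_sum (fun u _ => hδ u) (Finset.mem_univ v)
    nlinarith [hg σ τ]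

lemma pow_mulVec_sub_bot_le {β : ℝ} (hβ : 0 < β) {g : Config V → ℝ} {M : ℝ} (hM : 0 ≤ M)
    (hg : ∀ σ τ, g σ - g τ ≤ M) (t : ℕ) (σ : Config V) :
    (msw G β ^ t).mulVec g σ - (msw G β ^ t).mulVec g ⊥ ≤ M * ∑ v, extremalGap G β t v := by
  have hmono : Monotone fun σ => M * ∑ v, plusInd v σ - g σ := by
    intro τ σ h
    have := sub_le_mul_sum_plusInd hM hg h
    rw [Finset.sum_sub_distrib] at this
    dsimp only
    linarith
  have hF : Monotone fun σ : Config V => M * ∑ v, plusInd v σ := fun τ σ h =>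
    mul_le_mul_of_nonneg_left (Finset.sum_le_sum fun v _ => monotone_plusInd v h) hM
  have h1 := monotone_pow_mulVec G hβ Set.univ hmono t (bot_le (a := σ))
  have h2 := monotone_pow_mulVec G hβ Set.univ hF t (le_top (a := σ))
  have e1 : ∀ σ, (mswCensored G β Set.univ ^ t).mulVec (fun σ => M * ∑ v, plusInd v σ) σ =
      M * ∑ v, (msw G β ^ t).mulVec (plusInd v) σ := by
    intro σ
    simp only [msw, Matrix.mulVec, dotProduct, Finset.mul_sum]
    rw [Finset.sum_comm]
    exact Finset.sum_congr rfl fun v _ => Finset.sum_congr rfl fun τ _ => by ring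
  have e2 : ∀ σ, (mswCensored G β Set.univ ^ t).mulVec (fun σ => M * ∑ v, plusInd v σ - g σ) σ =
      M * ∑ v, (msw G β ^ t).mulVec (plusInd v) σ - (msw G β ^ t).mulVec g σ := by
    intro σ
    rw [← e1]
    simp only [msw, Matrix.mulVec, dotProduct, mul_sub, Finset.sum_sub_distrib]
  rw [e2, e2] at h1
  rw [e1, e1] at h2
  simp only [extremalGap, Finset.sum_sub_distrib, mul_sub]
  linarith

lemma abs_pow_mulVec_sub_le {β : ℝ} (hβ : 0 < β) {g : Config V → ℝ} {M : ℝ} (hM : 0 ≤ M)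
    (hg : ∀ σ τ, g σ - g τ ≤ M) (t : ℕ) (σ τ : Config V) :
    |(msw G β ^ t).mulVec g σ - (msw G β ^ t).mulVec g τ| ≤
      2 * (M * ∑ v, extremalGap G β t v) := by
  have hg' : ∀ σ τ, (-g) σ - (-g) τ ≤ M := fun σ τ => by
    have := hg τ σ
    simp only [Pi.neg_apply]
    linarith
  have h1 := pow_mulVec_sub_bot_le G hβ hM hg t σ
  have h2 := pow_mulVec_sub_bot_le G hβ hM hg t τ
  have h3 := pow_mulVec_sub_bot_le G hβ hM hg' t σ
  have h4 := pow_mulVec_sub_bot_le G hβ hM hg' t τ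
  simp only [Matrix.mulVec_neg, Pi.neg_apply] at h3 h4
  rw [abs_le]
  constructor <;> linarith

lemma sum_gibbs_mul_pow_mulVec {β : ℝ} (hβ : 0 < β) (g : Config V → ℝ) (t : ℕ) :
    ∑ τ, gibbs G β τ * (msw G β ^ t).mulVec g τ = ∑ τ, gibbs G β τ * g τ := by
  have hrev : IsReversible (gibbs G β) (msw G β) := mswCensored_isReversible G β Set.univ
  have hst : msw G β ^ t ∈ Matrix.rowStochastic ℝ (Config V) :=
    pow_mem (mswCensored_mem_rowStochastic G hβ Set.univ) t
  have h := hrev.innerMu_pow_mulVec t g 1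
  rw [Matrix.one_vecMul_of_mem_rowStochastic hst] at h
  simpa [innerMu] using h

lemma abs_pow_mulVec_sub_mean_le {β : ℝ} (hβ : 0 < β) {g : Config V → ℝ} {M : ℝ} (hM : 0 ≤ M)
    (hg : ∀ σ τ, g σ - g τ ≤ M) (t : ℕ) (σ : Config V) :
    |(msw G β ^ t).mulVec g σ - ∑ τ, gibbs G β τ * g τ| ≤
      2 * (M * ∑ v, extremalGap G β t v) := by
  have e : (msw G β ^ t).mulVec g σ - ∑ τ, gibbs G β τ * g τ =
      ∑ τ, gibbs G β τ * ((msw G β ^ t).mulVec g σ - (msw G β ^ t).mulVec g τ) := by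
    simp only [mul_sub, Finset.sum_sub_distrib]
    rw [sum_gibbs_mul_pow_mulVec G hβ, ← Finset.sum_mul, sum_gibbs, one_mul]
  rw [e]
  refine (Finset.abs_sum_le_sum_abs _ _).trans ?_
  rw [← one_mul (2 * _), ← sum_gibbs G β, Finset.sum_mul]
  refine Finset.sum_le_sum fun τ _ => ?_
  rw [abs_mul, abs_of_pos (gibbs_pos G β τ)]
  exact mul_le_mul_of_nonneg_left (abs_pow_mulVec_sub_le G hβ hM hg t σ τ) (gibbs_pos G β τ).le

lemma tvDist_msw_pow_le {β : ℝ} (hβ : 0 < β) (t : ℕ) (σ : Config V) :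
    tvDist (fun τ => (msw G β ^ t) σ τ) (gibbs G β) ≤ 2 * ∑ v, extremalGap G β t v := by
  set g : Config V → ℝ := fun τ => if gibbs G β τ ≤ (msw G β ^ t) σ τ then 1 / 2 else -(1 / 2)
    with hg
  have hosc : ∀ σ τ, g σ - g τ ≤ 1 := by
    intro σ τ
    simp only [hg]
    split_ifs <;> norm_num
  have h := abs_pow_mulVec_sub_mean_le G hβ zero_le_one hosc t σ
  rw [one_mul] at h
  refine le_trans (le_of_eq ?_) ((le_abs_self _).trans h)
  rw [tvDist, Matrix.mulVec, dotProduct, ← Finset.sum_sub_distrib, Finset.mul_sum]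
  refine Finset.sum_congr rfl fun τ _ => ?_
  simp only [hg]
  split_ifs with hc
  · rw [abs_of_nonneg (sub_nonneg.2 hc)]
    ring
  · rw [abs_of_neg (sub_neg.2 (not_le.1 hc))]
    ring

lemma mixingTime_le {S : Type*} [Fintype S] [DecidableEq S] {P : Matrix S S ℝ} {μ : S → ℝ}
    {ε : ℝ} {t : ℕ} (h : ∀ x, tvDist (fun y => (P ^ t) x y) μ ≤ ε) :
    mixingTime P μ ε ≤ t :=
  iSup_le fun x => iInf₂_le t (h x)

lemma abs_eigenvalue_pow_le {β : ℝ} (hβ : 0 < β) {m : ℕ}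
    (hm : ∀ (k : ℕ) (v : V), extremalGap G β (k * m) v ≤ (1 / 2) ^ k) {l : ℝ}
    (hl : Module.End.HasEigenvalue (Matrix.toLin' (msw G β)) l) (hl1 : l ≠ 1) :
    |l| ^ m ≤ 1 / 2 := by
  obtain ⟨f, hf⟩ := hl.exists_hasEigenvector
  have hPf : (msw G β).mulVec f = l • f := by
    rw [← Matrix.toLin'_apply]
    exact hf.apply_eq_smul
  have hpow : ∀ t : ℕ, (msw G β ^ t).mulVec f = l ^ t • f := by
    intro t
    induction t with
    | zero => simp
    | succ t ih => rw [pow_succ_mulVec, ih, Matrix.mulVec_smul, hPf, smul_smul, pow_succ]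
  have hmean : ∑ τ, gibbs G β τ * f τ = 0 := by
    have h := sum_gibbs_mul_pow_mulVec G hβ f 1
    rw [hpow, pow_one] at h
    simp only [Pi.smul_apply, smul_eq_mul, mul_left_comm _ l, ← Finset.mul_sum] at h
    have h' : (l - 1) * ∑ τ, gibbs G β τ * f τ = 0 := by linarith
    exact (mul_eq_zero.1 h').resolve_left (sub_ne_zero.2 hl1)
  obtain ⟨σ, hσ⟩ := Function.ne_iff.1 hf.2
  have hσ : 0 < |f σ| := abs_pos.2 hσ
  set M := 2 * ∑ τ, |f τ| with hM
  have hM0 : 0 ≤ M := by positivity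
  have hosc : ∀ σ τ, f σ - f τ ≤ M := by
    intro σ τ
    have h1 := Finset.single_le_sum (fun τ _ => abs_nonneg (f τ)) (Finset.mem_univ σ)
    have h2 := Finset.single_le_sum (fun τ _ => abs_nonneg (f τ)) (Finset.mem_univ τ)
    have h3 := le_abs_self (f σ)
    have h4 := neg_abs_le (f τ)
    linarith
  by_contra! hcon
  have hbound : ∀ k : ℕ, (2 * |l| ^ m) ^ k ≤ 2 * (M * Fintype.card V) / |f σ| := by
    intro k
    have h1 := abs_pow_mulVec_sub_mean_le G hβ hM0 hosc (k * m) σ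
    rw [hmean, sub_zero, hpow, Pi.smul_apply, smul_eq_mul, abs_mul, abs_pow] at h1
    have h2 : ∑ v, extremalGap G β (k * m) v ≤ Fintype.card V * (1 / 2) ^ k := by
      refine (Finset.sum_le_sum fun v _ => hm k v).trans_eq ?_
      rw [Finset.sum_const, Finset.card_univ, nsmul_eq_mul]
    rw [le_div_iff₀ hσ, mul_pow, ← pow_mul, mul_comm m k]
    have h3 := h1.trans (mul_le_mul_of_nonneg_left (mul_le_mul_of_nonneg_left h2 hM0) zero_le_two)
    have h4 := mul_le_mul_of_nonneg_left h3 (pow_nonneg (zero_le_two (α := ℝ)) k)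
    have h5 : (2 : ℝ) ^ k * (1 / 2) ^ k = 1 := by
      rw [← mul_pow]
      norm_num
    calc 2 ^ k * |l| ^ (k * m) * |f σ| = 2 ^ k * (|l| ^ (k * m) * |f σ|) := by ring
      _ ≤ _ := h4
      _ = 2 * (M * Fintype.card V) := by
        linear_combination (2 * (M * Fintype.card V)) * h5
  obtain ⟨k, hk⟩ := pow_unbounded_of_one_lt (2 * (M * Fintype.card V) / |f σ|)
    (show 1 < 2 * |l| ^ m by linarith)
  exact absurd (hbound k) (not_le.2 hk)

end Mixing

lemma exists_isCriticalBeta {d : ℕ} (hd : 3 ≤ d) : ∃ βc : ℝ, IsCriticalBeta d βc := by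
  have hd' : (3 : ℝ) ≤ d := by exact_mod_cast hd
  refine ⟨Real.artanh (1 / ((d : ℝ) - 1)), ?_⟩
  rw [IsCriticalBeta, Real.tanh_artanh]
  · field_simp
    have : (d : ℝ) - 1 ≠ 0 := by linarith
    exact div_self this
  · rw [Set.mem_Ioo]
    constructor
    · have : 0 < 1 / ((d : ℝ) - 1) := by
        apply one_div_pos.2
        linarith
      linarith
    · rw [div_lt_one] <;> linarith

lemma sub_one_mul_tanh_lt_one {d : ℕ} {β : ℝ} (hd : 2 ≤ d)
    (h : ∀ βc : ℝ, IsCriticalBeta d βc → β < βc) : ((d - 1 : ℕ) : ℝ) * Real.tanh β < 1 := by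
  rcases Nat.lt_or_ge 2 d with h3 | h2
  · obtain ⟨βc, hc⟩ := exists_isCriticalBeta h3
    have hlt : Real.tanh β < Real.tanh βc := by
      rw [← Real.artanh_lt_artanh_iff ⟨Real.neg_one_lt_tanh β, Real.tanh_lt_one β⟩
        ⟨Real.neg_one_lt_tanh βc, Real.tanh_lt_one βc⟩, Real.artanh_tanh, Real.artanh_tanh]
      exact h βc hc
    rw [IsCriticalBeta] at hc
    have hd' : (0 : ℝ) < d - 1 := by
      have : (3 : ℝ) ≤ d := by exact_mod_cast h3
      linarith
    rw [Nat.cast_sub (by omega), Nat.cast_one]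
    exact (mul_lt_mul_of_pos_left hlt hd').trans_eq hc
  · obtain rfl : d = 2 := by omega
    simpa using Real.tanh_lt_one β

theorem exists_mixing_bounds (d : ℕ) {β : ℝ} (hβ : 0 < β)
    (h : ∀ βc : ℝ, IsCriticalBeta d βc → β < βc) :
    ∃ C c₁ c₂ : ℝ, 0 < C ∧ 0 < c₁ ∧ 0 < c₂ ∧
      ∀ (V : Type u) [Fintype V] [DecidableEq V] [Nonempty V]
        (G : SimpleGraph V) [DecidableRel G.Adj], (∀ v, G.degree v ≤ d) →
        (2 ≤ Fintype.card V →
          ∃ t : ℕ, mixingTime (msw G β) (gibbs G β) (1 / 4) = (t : ℕ∞) ∧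
            (t : ℝ) ≤ C * Real.log (Fintype.card V)) ∧
        c₁ ≤ relaxationTime (msw G β) ∧ relaxationTime (msw G β) ≤ c₂ := by
  obtain ⟨D, hD1, hdD, hκ⟩ : ∃ D : ℕ, 1 ≤ D ∧ d ≤ D + 1 ∧ D * Real.tanh β < 1 := by
    rcases Nat.lt_or_ge d 2 with h2 | h2
    · exact ⟨1, le_rfl, by omega, by simpa using Real.tanh_lt_one β⟩
    · exact ⟨d - 1, by omega, by omega, sub_one_mul_tanh_lt_one h2 h⟩
  obtain ⟨m, hm1, hm⟩ := exists_extremalGap_le.{u} hβ hD1 hκ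
  have hm0 : (0 : ℝ) < m := by exact_mod_cast hm1
  have hlog2 := Real.log_pos one_lt_two
  set ρ : ℝ := (1 / 2) ^ (1 / (m : ℝ)) with hρ
  have hρ0 : 0 ≤ ρ := by positivity
  have hρ1 : ρ < 1 := Real.rpow_lt_one (by norm_num) (by norm_num) (by positivity)
  refine ⟨5 * m / Real.log 2, 1, (1 - ρ)⁻¹, by positivity, one_pos, inv_pos.2 (by linarith), ?_⟩
  intro V _ _ _ G _ hdeg
  have hgap := hm V G fun v => (hdeg v).trans hdD
  refine ⟨fun hn => ?_, ?_⟩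
  · set n := Fintype.card V with hndef
    set L := Nat.log 2 n with hL
    have htv : ∀ σ, tvDist (fun τ => (msw G β ^ ((L + 4) * m)) σ τ) (gibbs G β) ≤ 1 / 4 := by
      intro σ
      refine (tvDist_msw_pow_le G hβ _ σ).trans ?_
      have h1 : ∑ v, extremalGap G β ((L + 4) * m) v ≤ n * (1 / 2) ^ (L + 4) := by
        refine (Finset.sum_le_sum fun v _ => hgap (L + 4) v).trans_eq ?_
        rw [Finset.sum_const, Finset.card_univ, nsmul_eq_mul]
      have h2 : (n : ℝ) ≤ 2 ^ (L + 1) := by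
        exact_mod_cast (Nat.lt_pow_succ_log_self one_lt_two n).le
      have h3 : (2 : ℝ) ^ (L + 1) * (1 / 2) ^ (L + 4) = 1 / 8 := by
        have : (2 : ℝ) ^ (L + 1) * (1 / 2) ^ (L + 1) = 1 := by
          rw [← mul_pow]
          norm_num
        rw [show L + 4 = L + 1 + 3 from rfl, pow_add (1 / 2 : ℝ) (L + 1) 3, ← mul_assoc, this]
        norm_num
      have h4 := mul_le_mul_of_nonneg_right h2 (pow_nonneg (by norm_num : (0 : ℝ) ≤ 1 / 2) (L + 4))
      linarith
    have hle := mixingTime_le htv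
    obtain ⟨t, ht⟩ := ENat.ne_top_iff_exists.1 (ne_top_of_le_ne_top (ENat.natCast_ne_top _) hle)
    refine ⟨t, ht.symm, ?_⟩
    rw [← ht] at hle
    have hle' : t ≤ (L + 4) * m := by exact_mod_cast hle
    have hL1 : 1 ≤ L := Nat.log_pos one_lt_two hn
    have h5 : (L : ℝ) * Real.log 2 ≤ Real.log n := by
      rw [← Real.log_pow]
      refine Real.log_le_log (by positivity) ?_
      exact_mod_cast Nat.pow_log_le_self 2 (by omega)
    have h6 : (t : ℝ) ≤ 5 * L * m := by
      have : t ≤ 5 * L * m := hle'.trans (Nat.mul_le_mul_right _ (by omega))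
      exact_mod_cast this
    have h7 : 5 * (m : ℝ) / Real.log 2 * Real.log n = 5 * m * (Real.log n / Real.log 2) := by ring
    rw [h7]
    have h8 : (L : ℝ) ≤ Real.log n / Real.log 2 := (le_div_iff₀ hlog2).2 h5
    have h9 := mul_le_mul_of_nonneg_left h8 (by positivity : (0 : ℝ) ≤ 5 * m)
    linarith
  · have hstar0 : 0 ≤ lambdaStar (msw G β) := by
      refine Real.sSup_nonneg ?_
      rintro r ⟨l, -, -, rfl⟩
      exact abs_nonneg l
    have hstar1 : lambdaStar (msw G β) ≤ ρ := by
      refine Real.sSup_le ?_ hρ0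
      rintro r ⟨l, hl, hl1, rfl⟩
      have hpow := abs_eigenvalue_pow_le G hβ hgap hl hl1
      have h1 := Real.rpow_le_rpow (by positivity) hpow (by positivity : 0 ≤ 1 / (m : ℝ))
      rwa [one_div (m : ℝ), Real.pow_rpow_inv_natCast (abs_nonneg l) (by omega), ← one_div] at h1
    constructor
    · rw [relaxationTime, one_le_inv₀ (by linarith)]
      linarith
    · rw [relaxationTime]
      exact inv_anti₀ (by linarith) (by linarith)

end MonotoneSW

end
open MonotoneSW in
theorem theorem4 :
    (∀ (V : Type u) [Fintype V] [DecidableEq V] (G : SimpleGraph V) [DecidableRel G.Adj] (β : ℝ),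
      0 < β →
        IsErgodic (msw G β) ∧
        IsReversible (gibbs G β) (msw G β) ∧
        IsMonotone (msw G β) ∧
        IsCensoring (gibbs G β) (msw G β) (mswCensored G β)) ∧
    (∀ (d : ℕ) (β : ℝ), 0 < β → (∀ βc : ℝ, IsCriticalBeta d βc → β < βc) →
      ∃ C c₁ c₂ : ℝ, 0 < C ∧ 0 < c₁ ∧ 0 < c₂ ∧
        ∀ (V : Type u) [Fintype V] [DecidableEq V] [Nonempty V]
          (G : SimpleGraph V) [DecidableRel G.Adj], (∀ v, G.degree v ≤ d) →
          (2 ≤ Fintype.card V →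
            ∃ t : ℕ, mixingTime (msw G β) (gibbs G β) (1 / 4) = (t : ℕ∞) ∧
              (t : ℝ) ≤ C * Real.log (Fintype.card V)) ∧
          c₁ ≤ relaxationTime (msw G β) ∧ relaxationTime (msw G β) ≤ c₂) :=
  ⟨fun _ _ _ G _ β hβ => ⟨isErgodic_msw G hβ, mswCensored_isReversible G β Set.univ,
    mswCensored_isMonotone G hβ Set.univ, isCensoring_mswCensored G hβ⟩,
    fun d _ hβ h => exists_mixing_bounds d hβ h⟩
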